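/- Let $V$ be an $n$-dimensional complex vector space with a nondegenerate symmetric bilinear form, let $O(V)$ be its orthogonal group, and let $e_1,\dots,e_n$ be an orthonormal basis of $V$. Let $\Lambda_2(V)$ be the second exterior power of $V$, and let $O(V)$ act naturally on the exterior algebra $\Lambda(\Lambda_2(V))$ by algebra automorphisms. Put $a_{ij}=e_i\wedge e_j\in\Lambda_2(V)$, let $A=(a_{ij})_{1\le i,j\le n}\in\operatorname{Mat}_{n,n}(\Lambda(\Lambda_2(V)))$, and put $q_k=\operatorname{tr}(A^k)$. Then the algebra of invariants $\Lambda(\Lambda_2(V))^{O(V)}$ is generated by the following elements, and these anticommute with each other and have no other relations: \[ q_3,\,q_7,\,q_{11},\,\dots,\,q_{4m-5}\quad\text{if } n=2m,\qquad q_3,\,q_7,\,q_{11},\,\dots,\,q_{4m-1}\quad\text{if } n=2m+1. \] That is, $\Lambda(\Lambda_2(V))^{O(V)}$ is freely generated, as an exterior algebra, by these elements. (For $n\le 2$ the list is empty and the algebra of invariants is $\mathbb{C}$.) -/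

import Mathlib

noncomputable section

/-- The orthogonal group `O(V)` of a complex vector space `V` with a bilinear form `B`:
the linear automorphisms of `V` that preserve `B`. -/
def orthogonalGroupOf {V : Type*} [AddCommGroup V] [Module ℂ V]
    (B : LinearMap.BilinForm ℂ V) : Subgroup (V ≃ₗ[ℂ] V) where
  carrier := {g | ∀ v w : V, B (g v) (g w) = B v w}
  mul_mem' := by
    intro g h hg hh v w
    rw [LinearEquiv.mul_apply, LinearEquiv.mul_apply, hg, hh]
  one_mem' := by
    intro v w
    rfl
  inv_mem' := by
    intro g hg v w
    rw [← hg (g⁻¹ v) (g⁻¹ w), ← LinearEquiv.mul_apply, ← LinearEquiv.mul_apply, mul_inv_cancel]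
    rfl

/-- The exterior algebra `Λ(Λ₂(V))` on the second exterior power `Λ₂(V)` of `V`. -/
abbrev ExtAlgLambdaTwo (V : Type*) [AddCommGroup V] [Module ℂ V] : Type _ :=
  ExteriorAlgebra ℂ (⋀[ℂ]^2 V)

/-- The natural action `π(g)` of a linear map `g` on `Λ(Λ₂(V))`: the algebra endomorphism induced
by `v ∧ w ↦ g v ∧ g w` on `Λ₂(V)`. -/
def lambdaTwoAction {V : Type*} [AddCommGroup V] [Module ℂ V] (g : V →ₗ[ℂ] V) :
    ExtAlgLambdaTwo V →ₐ[ℂ] ExtAlgLambdaTwo V :=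
  ExteriorAlgebra.map (exteriorPower.map 2 g)

/-- The algebra of invariants `Λ(Λ₂(V))^{O(V)}`. -/
def orthogonalInvariants {V : Type*} [AddCommGroup V] [Module ℂ V]
    (B : LinearMap.BilinForm ℂ V) : Subalgebra ℂ (ExtAlgLambdaTwo V) where
  carrier := {x | ∀ g ∈ orthogonalGroupOf B, lambdaTwoAction (g : V →ₗ[ℂ] V) x = x}
  mul_mem' := by
    intro x y hx hy g hg
    rw [map_mul, hx g hg, hy g hg]
  add_mem' := by
    intro x y hx hy g hg
    rw [map_add, hx g hg, hy g hg]
  algebraMap_mem' := by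
    intro r g _
    exact AlgHom.commutes _ r

/-- The matrix `A = (a_{ij})` over `Λ(Λ₂(V))` with entries `a_{ij} = e_i ∧ e_j ∈ Λ₂(V)`. -/
def matrixA {V : Type*} [AddCommGroup V] [Module ℂ V] {n : ℕ} (e : Fin n → V) :
    Matrix (Fin n) (Fin n) (ExtAlgLambdaTwo V) :=
  Matrix.of fun i j => ExteriorAlgebra.ι ℂ (exteriorPower.ιMulti ℂ 2 ![e i, e j])

/-- `q_k = tr(A^k)`. -/
def qTrace {V : Type*} [AddCommGroup V] [Module ℂ V] {n : ℕ} (e : Fin n → V) (k : ℕ) :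
    ExtAlgLambdaTwo V :=
  (matrixA e ^ k).trace

/-- The subalgebra `S` of `R` is freely generated, as an exterior algebra, by `x_0, …, x_{r-1}`:
these elements generate `S`, they anticommute with each other, and they have no other relations,
that is, the homomorphism from the exterior algebra on `r` generators to `R` which sends the
`i`-th generator to `x_i` exists and is injective. -/
structure FreelyGeneratedAsExteriorAlgebra {R : Type*} [Ring R] [Algebra ℂ R]
    (S : Subalgebra ℂ R) {r : ℕ} (x : Fin r → R) : Prop where
  generates : Algebra.adjoin ℂ (Set.range x) = S
  anticommute : ∀ i j, x i * x j = -(x j * x i)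
  no_other_relations : ∃ φ : ExteriorAlgebra ℂ (Fin r → ℂ) →ₐ[ℂ] R,
    (∀ i, φ (ExteriorAlgebra.ι ℂ (Pi.single i 1)) = x i) ∧ Function.Injective φ

end

noncomputable section

/-! ### Moments of the one-dimensional Gaussian. -/

open MeasureTheory ProbabilityTheory

/-! Let `A` be the matrix of the `e_i ∧ e_j`; it is skew and its entries anticommute. Let `T` be the
algebra generated by the traces of its positive powers.

Generation. A matrix `G` acts by substituting `Gᵀ A G` for `A`. Let `W` be the average of this
action over real `G` with independent standard Gaussian entries. Stein's identity removes the
entries of `G` in pairs, gluing words `Gᵀ A^k G` together or closing them into traces, so `W` has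
values in `T` (`exists_gaussian_average`). For the Hermitian form making the basis attached to `e`
orthonormal, the adjoint of `G` is its conjugate transpose. If `x` is invariant and `G = O S²` with
`O` orthogonal and `S` symmetric, then `⟨x, G x⟩ = ⟨S x, S x⟩ ≥ 0`, with strict inequality at `G =
1` when `x ≠ 0`. Hence `W` is injective on the finite-dimensional space of invariants; its values
lie in `T`, which consists of invariants, so `T` is all of them (`traceAlgebra_eq_invariants`).

Vanishing. Reversal and cyclic rotation kill `tr A^k` for `k > 0` unless `k ≡ 3 mod 4`. For large
`k`, adjoin odd variables `x`, `y` and put `M = A²`, a skew matrix over the commutative even part.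
Conjugation by `1 + xA` multiplies `M + yA` by `1 - 2xy`. Comparing characteristic polynomials and
Pfaffians shows that the nonleading coefficients and the Pfaffian of `M` are killed by `xy`, hence
are zero. Cayley–Hamilton for `M` gives `A^(2n) = 0`; the trace of Cayley–Hamilton for `M + yA`
gives `tr A^(2n-1) = 0` (`oddMatrix_pow_eq_zero`, `trace_oddMatrix_pow_eq_zero`).

Freeness. It suffices that the product of the generators is nonzero
(`injective_of_map_basis_univ_ne_zero`). For `n = 2r + 1` its degree is `dim Λ₂(V)`. Real matrices
scale the top form by nonnegative numbers, so `W` multiplies it by a positive number and it lies in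
`T`; only the full product of the generators can reach that degree. For even `n`, sending the last
basis vector to zero reduces to the odd case. -/

theorem integrable_pow_gaussianReal (k : ℕ) :
    Integrable (fun x : ℝ => x ^ k) (gaussianReal 0 1) := by
  have h := (memLp_id_gaussianReal' (μ := 0) (v := 1) (k : ENNReal) (by simp)).integrable_norm_pow'
  exact h.mono' (by fun_prop) (Filter.Eventually.of_forall fun x => by simp)

theorem integrable_pow_mul_gaussianPDFReal (k : ℕ) :
    Integrable (fun x : ℝ => x ^ k * gaussianPDFReal 0 1 x) := by
  have h := integrable_pow_gaussianReal k
  rw [gaussianReal_of_var_ne_zero _ one_ne_zero,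
    integrable_withDensity_iff_integrable_smul' (measurable_gaussianPDF 0 1)
      (Filter.Eventually.of_forall fun _ => gaussianPDF_lt_top)] at h
  simpa [toReal_gaussianPDF, mul_comm] using h

theorem hasDerivAt_gaussianPDFReal (x : ℝ) :
    HasDerivAt (gaussianPDFReal 0 1) (-(x * gaussianPDFReal 0 1 x)) x := by
  have h : HasDerivAt (fun y : ℝ => -(y - 0) ^ 2 / (2 * ((1 : NNReal) : ℝ))) (-x) x := by
    have := (((hasDerivAt_id x).sub_const 0).pow 2).neg.div_const (2 * ((1 : NNReal) : ℝ))
    convert! this using 1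
    simp
    ring
  have h2 := (h.exp).const_mul ((Real.sqrt (2 * Real.pi * ((1 : NNReal) : ℝ)))⁻¹)
  rw [gaussianPDFReal_def]
  convert! h2 using 1
  ring

/-- Stein's identity for the moments of the standard Gaussian. -/
theorem integral_pow_succ_gaussianReal (k : ℕ) :
    ∫ x, x ^ (k + 1) ∂(gaussianReal 0 1) = k * ∫ x, x ^ (k - 1) ∂(gaussianReal 0 1) := by
  rw [integral_gaussianReal_eq_integral_smul one_ne_zero,
    integral_gaussianReal_eq_integral_smul one_ne_zero]
  -- Integration by parts: the density has derivative `-x` times itself. At `k = 0` the truncated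
  -- exponent is harmless because of the factor `k`.
  have h := integral_mul_deriv_eq_deriv_mul_of_integrable
    (u := fun x : ℝ => x ^ k) (v := gaussianPDFReal 0 1)
    (u' := fun x => k * x ^ (k - 1)) (v' := fun x => -(x * gaussianPDFReal 0 1 x))
    (fun x _ => hasDerivAt_pow k x) (fun x _ => hasDerivAt_gaussianPDFReal x)
    (by
      have := (integrable_pow_mul_gaussianPDFReal (k + 1)).neg
      convert! this using 1
      ext x
      simp
      ring)
    (by
      have := (integrable_pow_mul_gaussianPDFReal (k - 1)).const_mul (k : ℝ)
      convert! this using 1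
      ext x
      simp
      ring)
    (integrable_pow_mul_gaussianPDFReal k)
  have e1 : ∀ x : ℝ, gaussianPDFReal 0 1 x • x ^ (k + 1)
      = -(x ^ k * -(x * gaussianPDFReal 0 1 x)) := by
    intro x
    simp
    ring
  have e2 : ∀ x : ℝ, (k * x ^ (k - 1)) * gaussianPDFReal 0 1 x
      = k * (gaussianPDFReal 0 1 x • x ^ (k - 1)) := by
    intro x
    simp
    ring
  simp_rw [e1]
  rw [integral_neg, h, neg_neg]
  simp_rw [e2]
  rw [integral_const_mul]

/-! ### Polynomials in independent Gaussian variables. -/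

section Gauss

variable {σ : Type*} [Fintype σ]

/-- The standard Gaussian measure on `σ → ℝ`. -/
abbrev stdGaussianPi (σ : Type*) [Fintype σ] : Measure (σ → ℝ) :=
  Measure.pi fun _ => gaussianReal 0 1

instance : (gaussianReal 0 1).IsOpenPosMeasure :=
  (gaussianReal_absolutelyContinuous' 0 one_ne_zero).isOpenPosMeasure

theorem eval_ofReal_monomial (m : σ →₀ ℕ) (c : ℂ) (x : σ → ℝ) :
    MvPolynomial.eval (fun i => (x i : ℂ)) (MvPolynomial.monomial m c)
      = c * ∏ i, ((x i : ℂ)) ^ m i := by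
  rw [MvPolynomial.eval_monomial, Finsupp.prod_fintype]
  simp

theorem integrable_eval_stdGaussianPi (f : MvPolynomial σ ℂ) :
    Integrable (fun x : σ → ℝ => MvPolynomial.eval (fun i => (x i : ℂ)) f)
      (stdGaussianPi σ) := by
  induction f using MvPolynomial.induction_on' with
  | monomial m c =>
    simp_rw [eval_ofReal_monomial]
    refine Integrable.const_mul ?_ c
    refine Integrable.fintype_prod (f := fun i (y : ℝ) => (y : ℂ) ^ m i) fun i => ?_
    simpa using (integrable_pow_gaussianReal (m i)).ofReal (𝕜 := ℂ)
  | add p q hp hq =>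
    simp_rw [map_add]
    exact hp.add hq

/-- The expectation of a polynomial in independent standard Gaussian variables. -/
def gaussianExpectation (σ : Type*) [Fintype σ] : MvPolynomial σ ℂ →ₗ[ℂ] ℂ where
  toFun f := ∫ x : σ → ℝ, MvPolynomial.eval (fun i => (x i : ℂ)) f ∂(stdGaussianPi σ)
  map_add' f g := by
    simp_rw [map_add]
    exact integral_add (integrable_eval_stdGaussianPi f) (integrable_eval_stdGaussianPi g)
  map_smul' c f := by
    simp_rw [MvPolynomial.smul_eval]
    exact integral_const_mul _ _

theorem gaussianExpectation_monomial (m : σ →₀ ℕ) (c : ℂ) :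
    gaussianExpectation σ (MvPolynomial.monomial m c)
      = c * ∏ i, ((∫ x, x ^ m i ∂(gaussianReal 0 1) : ℝ) : ℂ) := by
  change ∫ x : σ → ℝ, MvPolynomial.eval (fun i => (x i : ℂ)) _ ∂(stdGaussianPi σ) = _
  simp_rw [eval_ofReal_monomial]
  rw [integral_const_mul]
  congr 1
  rw [integral_fintype_prod_eq_prod (f := fun i (y : ℝ) => (y : ℂ) ^ m i)]
  refine Finset.prod_congr rfl fun i _ => ?_
  rw [← integral_complex_ofReal]
  simp

/-- Stein's identity for polynomials in independent standard Gaussian variables. -/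
theorem gaussianExpectation_X_mul (a : σ) (f : MvPolynomial σ ℂ) :
    gaussianExpectation σ (MvPolynomial.X a * f)
      = gaussianExpectation σ (MvPolynomial.pderiv a f) := by
  classical
  induction f using MvPolynomial.induction_on' with
  | monomial m c =>
    rw [MvPolynomial.pderiv_monomial, MvPolynomial.X, MvPolynomial.monomial_mul,
      gaussianExpectation_monomial, gaussianExpectation_monomial,
      ← Finset.mul_prod_erase _ _ (Finset.mem_univ a),
      ← Finset.mul_prod_erase _ _ (Finset.mem_univ a)]
    have h : ∀ i ∈ Finset.univ.erase a,
        ((∫ x, x ^ ((Finsupp.single a 1 + m : σ →₀ ℕ) i) ∂(gaussianReal 0 1) : ℝ) : ℂ)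
          = ((∫ x, x ^ ((m - Finsupp.single a 1 : σ →₀ ℕ) i) ∂(gaussianReal 0 1) : ℝ) : ℂ) := by
      intro i hi
      have hia : a ≠ i := (Finset.ne_of_mem_erase hi).symm
      simp [Finsupp.single_eq_of_ne' hia]
    rw [Finset.prod_congr rfl h]
    have h1 : (Finsupp.single a 1 + m : σ →₀ ℕ) a = m a + 1 := by simp [add_comm]
    have h2 : (m - Finsupp.single a 1 : σ →₀ ℕ) a = m a - 1 := by simp
    rw [h1, h2, integral_pow_succ_gaussianReal]
    push_cast
    ring
  | add p q hp hq => rw [mul_add, map_add, hp, hq, map_add, map_add]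

/-- The Gaussian measure charges every nonempty open set, so a single point of strict positivity
suffices. This yields both the injectivity of the average on invariants and its nonvanishing on the
top form. -/
theorem gaussianExpectation_re_pos (f : MvPolynomial σ ℂ)
    (hf : ∀ x : σ → ℝ, 0 ≤ (MvPolynomial.eval (fun i => (x i : ℂ)) f).re)
    (x₀ : σ → ℝ) (hx₀ : 0 < (MvPolynomial.eval (fun i => (x₀ i : ℂ)) f).re) :
    0 < (gaussianExpectation σ f).re := by
  have hc : Continuous fun x : σ → ℝ => (MvPolynomial.eval (fun i => (x i : ℂ)) f).re := by
    refine Complex.continuous_re.comp ((MvPolynomial.continuous_eval f).comp ?_)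
    fun_prop
  have hre : (gaussianExpectation σ f).re
      = ∫ x : σ → ℝ, (MvPolynomial.eval (fun i => (x i : ℂ)) f).re ∂(stdGaussianPi σ) :=
    (integral_re (𝕜 := ℂ) (integrable_eval_stdGaussianPi f)).symm
  rw [hre, integral_pos_iff_support_of_nonneg hf (integrable_eval_stdGaussianPi f).re]
  exact hc.isOpen_support.measure_pos _ ⟨x₀, hx₀.ne'⟩

end Gauss

/-! ### Matrices with anticommuting entries -/

section AnticommutingEntries

variable {ι R : Type*} [Fintype ι] [DecidableEq ι] [Ring R]

theorem neg_one_pow_mul_comm (m : ℕ) (x : R) : (-1 : R) ^ m * x = x * (-1) ^ m :=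
  (((Commute.neg_one_left x)).pow_left m).eq

theorem entry_mul_pow_entry {a : Matrix ι ι R}
    (hA : ∀ i j k l, a i j * a k l = -(a k l * a i j)) (l : ℕ) (i j p q : ι) :
    a i j * (a ^ l) p q = (-1) ^ l * ((a ^ l) p q * a i j) := by
  induction l generalizing p q with
  | zero =>
    by_cases h : p = q <;> simp [h]
  | succ l ih =>
    rw [pow_succ, Matrix.mul_apply, Finset.mul_sum, Finset.sum_mul, Finset.mul_sum]
    refine Finset.sum_congr rfl fun r _ => ?_
    rw [← mul_assoc, ih, mul_assoc, mul_assoc, hA i j r q, pow_succ]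
    simp [mul_assoc]

theorem pow_entry_mul_pow_entry {a : Matrix ι ι R}
    (hA : ∀ i j k l, a i j * a k l = -(a k l * a i j)) (k l : ℕ) (i j p q : ι) :
    (a ^ k) i j * (a ^ l) p q = (-1) ^ (k * l) * ((a ^ l) p q * (a ^ k) i j) := by
  induction k generalizing i j with
  | zero =>
    by_cases h : i = j <;> simp [h]
  | succ k ih =>
    rw [pow_succ, Matrix.mul_apply, Finset.sum_mul, Finset.mul_sum, Finset.mul_sum]
    refine Finset.sum_congr rfl fun r _ => ?_
    rw [mul_assoc, entry_mul_pow_entry hA, ← mul_assoc, ← neg_one_pow_mul_comm, mul_assoc,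
      ← mul_assoc ((a ^ k) i r), ih, add_mul, one_mul, pow_add, neg_one_pow_mul_comm (k * l),
      neg_one_pow_mul_comm (k * l)]
    simp only [mul_assoc, neg_one_pow_mul_comm (k * l)]

/-- Skewness contributes `k` signs, and reversing a product of `k` anticommuting factors contributes
`k(k-1)/2` more. -/
theorem pow_entry_transpose {a : Matrix ι ι R} (hT : ∀ i j, a j i = -a i j)
    (hA : ∀ i j k l, a i j * a k l = -(a k l * a i j)) (k : ℕ) (i j : ι) :
    (a ^ k) j i = (-1) ^ (k * (k + 1) / 2) * (a ^ k) i j := by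
  induction k generalizing i j with
  | zero =>
    by_cases h : i = j
    · simp [h]
    · simp [h, Ne.symm h]
  | succ k ih =>
    have hk : (k + 1) * (k + 1 + 1) / 2 = k * (k + 1) / 2 + k + 1 := by
      rw [show (k + 1) * (k + 1 + 1) = k * (k + 1) + (k + 1) * 2 by ring,
        Nat.add_mul_div_right _ _ two_pos, add_assoc]
    rw [pow_succ', Matrix.mul_apply, ← pow_succ', pow_succ, Matrix.mul_apply, Finset.mul_sum, hk]
    refine Finset.sum_congr rfl fun r _ => ?_
    rw [ih i r, hT r j, ← mul_assoc, ← neg_one_pow_mul_comm, mul_assoc, neg_mul,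
      entry_mul_pow_entry hA, pow_succ, pow_add]
    simp [mul_assoc]

theorem trace_pow_eq_zero_of_transpose [IsAddTorsionFree R] {a : Matrix ι ι R}
    (hT : ∀ i j, a j i = -a i j) (hA : ∀ i j k l, a i j * a k l = -(a k l * a i j)) {k : ℕ}
    (hk : Odd (k * (k + 1) / 2)) : (a ^ k).trace = 0 := by
  refine Finset.sum_eq_zero fun i _ => ?_
  have h := pow_entry_transpose hT hA k i i
  rw [hk.neg_one_pow, neg_one_mul] at h
  exact self_eq_neg.mp h

/-- Rotating one factor cyclically past the `k` others costs the sign `(-1)^k = -1`. -/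
theorem trace_pow_eq_zero_of_even [IsAddTorsionFree R] {a : Matrix ι ι R}
    (hA : ∀ i j k l, a i j * a k l = -(a k l * a i j)) {k : ℕ}
    (hk : Odd k) : (a ^ (k + 1)).trace = 0 := by
  have h : (a ^ (k + 1)).trace = -(a ^ (k + 1)).trace := by
    conv_lhs => rw [pow_succ']
    rw [pow_succ]
    simp_rw [Matrix.trace, Matrix.diag_apply, Matrix.mul_apply]
    rw [Finset.sum_comm, ← Finset.sum_neg_distrib]
    refine Finset.sum_congr rfl fun i _ => ?_
    rw [← Finset.sum_neg_distrib]
    refine Finset.sum_congr rfl fun j _ => ?_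
    rw [entry_mul_pow_entry hA, hk.neg_one_pow, neg_one_mul]
  exact self_eq_neg.mp h

/-- Only the traces of the powers of exponent `4 * j + 3` can be nonzero. -/
theorem trace_pow_eq_zero_of_mod_ne [IsAddTorsionFree R] {a : Matrix ι ι R}
    (hT : ∀ i j, a j i = -a i j) (hA : ∀ i j k l, a i j * a k l = -(a k l * a i j)) {k : ℕ}
    (hk0 : k ≠ 0) (hk : k % 4 ≠ 3) : (a ^ k).trace = 0 := by
  obtain ⟨c, hc⟩ : ∃ c, k = 4 * c + k % 4 := ⟨k / 4, by omega⟩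
  have h4 : k % 4 < 4 := Nat.mod_lt _ (by norm_num)
  have h : k % 4 = 0 ∨ k % 4 = 1 ∨ k % 4 = 2 := by omega
  rcases h with h | h | h
  · obtain ⟨l, rfl⟩ := Nat.exists_eq_succ_of_ne_zero hk0
    exact trace_pow_eq_zero_of_even hA (Nat.odd_iff.mpr (by omega))
  · rw [h] at hc
    refine trace_pow_eq_zero_of_transpose hT hA ?_
    rw [hc, show (4 * c + 1) * (4 * c + 1 + 1) = (2 * (4 * c ^ 2 + 3 * c) + 1) * 2 by ring,
      Nat.mul_div_cancel _ two_pos]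
    exact ⟨_, rfl⟩
  · rw [h] at hc
    refine trace_pow_eq_zero_of_transpose hT hA ?_
    rw [hc, show (4 * c + 2) * (4 * c + 2 + 1) = (2 * (4 * c ^ 2 + 5 * c + 1) + 1) * 2 by ring,
      Nat.mul_div_cancel _ two_pos]
    exact ⟨_, rfl⟩

theorem trace_pow_mul_trace_pow {a : Matrix ι ι R}
    (hA : ∀ i j k l, a i j * a k l = -(a k l * a i j)) {k l : ℕ} (hk : Odd k) (hl : Odd l) :
    (a ^ k).trace * (a ^ l).trace = -((a ^ l).trace * (a ^ k).trace) := by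
  simp_rw [Matrix.trace, Matrix.diag_apply, Finset.sum_mul_sum]
  rw [Finset.sum_comm, ← Finset.sum_neg_distrib]
  refine Finset.sum_congr rfl fun i _ => ?_
  rw [← Finset.sum_neg_distrib]
  refine Finset.sum_congr rfl fun j _ => ?_
  rw [pow_entry_mul_pow_entry hA, (hk.mul hl).neg_one_pow, neg_one_mul]

end AnticommutingEntries

/-! ### Polynomials with coefficients in a noncommutative algebra -/

section PolynomialCoefficients

open TensorProduct

variable {σ R : Type*} [Ring R] [Algebra ℂ R]

/-- Coefficientwise partial derivative. -/
def coeffPderiv (R : Type*) [Ring R] [Algebra ℂ R] (s : σ) :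
    (MvPolynomial σ ℂ ⊗[ℂ] R) →ₗ[ℂ] (MvPolynomial σ ℂ ⊗[ℂ] R) :=
  LinearMap.rTensor R (MvPolynomial.pderiv s).toLinearMap

/-- Coefficientwise Gaussian expectation. -/
def coeffExpectation (σ R : Type*) [Fintype σ] [Ring R] [Algebra ℂ R] :
    (MvPolynomial σ ℂ ⊗[ℂ] R) →ₗ[ℂ] R :=
  (TensorProduct.lid ℂ R).toLinearMap ∘ₗ LinearMap.rTensor R (gaussianExpectation σ)

/-- Evaluation of a polynomial with coefficients in `R` at a scalar point. -/
def coeffEval (R : Type*) [Ring R] [Algebra ℂ R] (x : σ → ℂ) :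
    (MvPolynomial σ ℂ ⊗[ℂ] R) →ₐ[ℂ] R :=
  Algebra.TensorProduct.lift ((Algebra.ofId ℂ R).comp (MvPolynomial.aeval x)) (AlgHom.id ℂ R)
    fun _ r => Algebra.commutes _ r

/-- The variable `X s` as a polynomial with coefficients in `R`. -/
def coeffX (R : Type*) [Ring R] [Algebra ℂ R] (s : σ) : MvPolynomial σ ℂ ⊗[ℂ] R :=
  MvPolynomial.X s ⊗ₜ 1

/-- The constants in the polynomials with coefficients in `R`. -/
def coeffC (σ R : Type*) [Ring R] [Algebra ℂ R] : R →ₐ[ℂ] (MvPolynomial σ ℂ ⊗[ℂ] R) :=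
  Algebra.TensorProduct.includeRight


theorem coeffX_comm (s : σ) (f : MvPolynomial σ ℂ ⊗[ℂ] R) : coeffX R s * f = f * coeffX R s := by
  induction f using TensorProduct.induction_on with
  | zero => simp
  | tmul p r => simp [coeffX, Algebra.TensorProduct.tmul_mul_tmul, mul_comm]
  | add x y hx hy => rw [mul_add, add_mul, hx, hy]


theorem coeffPderiv_mul (s : σ) (f g : MvPolynomial σ ℂ ⊗[ℂ] R) :
    coeffPderiv R s (f * g) = coeffPderiv R s f * g + f * coeffPderiv R s g := by
  induction f using TensorProduct.induction_on with
  | zero => simp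
  | tmul p r =>
    induction g using TensorProduct.induction_on with
    | zero => simp
    | tmul p' r' =>
      simp only [coeffPderiv, Algebra.TensorProduct.tmul_mul_tmul, LinearMap.rTensor_tmul,
        Derivation.coeFn_coe, Derivation.leibniz, smul_eq_mul, TensorProduct.add_tmul]
      rw [add_comm, mul_comm p']
    | add x y hx hy =>
      simp only [mul_add, map_add, hx, hy]
      abel
  | add x y hx hy =>
    simp only [add_mul, map_add, hx, hy]
    abel


theorem coeffPderiv_coeffX [DecidableEq σ] (s t : σ) :
    coeffPderiv R s (coeffX R t) = if t = s then 1 else 0 := by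
  rw [coeffPderiv, coeffX, LinearMap.rTensor_tmul, Derivation.coeFn_coe, MvPolynomial.pderiv_X]
  by_cases h : t = s
  · subst h
    simp [Algebra.TensorProduct.one_def]
  · simp [h]


theorem coeffPderiv_coeffC (s : σ) (r : R) : coeffPderiv R s (coeffC σ R r) = 0 := by
  simp [coeffPderiv, coeffC]

theorem coeffExpectation_X_mul [Fintype σ] (s : σ) (f : MvPolynomial σ ℂ ⊗[ℂ] R) :
    coeffExpectation σ R (coeffX R s * f) = coeffExpectation σ R (coeffPderiv R s f) := by
  induction f using TensorProduct.induction_on with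
  | zero => simp
  | tmul p r =>
    simp [coeffExpectation, coeffX, coeffPderiv, Algebra.TensorProduct.tmul_mul_tmul,
      gaussianExpectation_X_mul]
  | add x y hx hy => rw [mul_add, map_add, hx, hy, map_add, map_add]

theorem coeffExpectation_C_mul [Fintype σ] (c : R) (f : MvPolynomial σ ℂ ⊗[ℂ] R) :
    coeffExpectation σ R (coeffC σ R c * f) = c * coeffExpectation σ R f := by
  induction f using TensorProduct.induction_on with
  | zero => simp
  | tmul p r =>
    simp [coeffExpectation, coeffC, Algebra.TensorProduct.tmul_mul_tmul]
  | add x y hx hy => rw [mul_add, map_add, hx, hy, map_add, mul_add]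

theorem gaussianExpectation_one [Fintype σ] : gaussianExpectation σ 1 = 1 := by
  rw [MvPolynomial.one_def, gaussianExpectation_monomial]
  simp

theorem coeffExpectation_one [Fintype σ] : coeffExpectation σ R 1 = 1 := by
  simp [coeffExpectation, Algebra.TensorProduct.one_def, gaussianExpectation_one]


theorem coeffEval_tmul (x : σ → ℂ) (p : MvPolynomial σ ℂ) (r : R) :
    coeffEval R x (p ⊗ₜ r) = MvPolynomial.eval x p • r := by
  rw [Algebra.smul_def, ← MvPolynomial.coe_aeval_eq_eval]
  exact Algebra.TensorProduct.lift_tmul _ _ _ p r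

@[simp]
theorem coeffEval_coeffX (x : σ → ℂ) (s : σ) :
    coeffEval R x (coeffX R s) = algebraMap ℂ R (x s) := by
  rw [coeffX, coeffEval_tmul, MvPolynomial.eval_X, Algebra.algebraMap_eq_smul_one]


@[simp]
theorem coeffEval_coeffC (x : σ → ℂ) (r : R) : coeffEval R x (coeffC σ R r) = r := by
  rw [coeffC, Algebra.TensorProduct.includeRight_apply, coeffEval_tmul, map_one, one_smul]

/-- A linear functional of the expectation is the expectation of the functional. -/
theorem exists_gaussianExpectation_eq [Fintype σ] (l : R →ₗ[ℂ] ℂ) (F : MvPolynomial σ ℂ ⊗[ℂ] R) :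
    ∃ f : MvPolynomial σ ℂ, gaussianExpectation σ f = l (coeffExpectation σ R F) ∧
      ∀ x : σ → ℂ, MvPolynomial.eval x f = l (coeffEval R x F) := by
  induction F using TensorProduct.induction_on with
  | zero => exact ⟨0, by simp, by simp⟩
  | tmul p r =>
    refine ⟨l r • p, ?_, fun x => ?_⟩
    · simp [coeffExpectation, mul_comm]
    · rw [coeffEval_tmul, MvPolynomial.smul_eval, map_smul, smul_eq_mul, mul_comm]
  | add F G hF hG =>
    obtain ⟨f, hf, hf'⟩ := hF
    obtain ⟨g, hg, hg'⟩ := hG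
    exact ⟨f + g, by simp [hf, hg], fun x => by simp [hf', hg']⟩

end PolynomialCoefficients

/-! ### Words in a Gaussian matrix and a matrix with anticommuting entries -/

section Words

open TensorProduct

variable {ι R : Type*} [Fintype ι] [DecidableEq ι] [Ring R] [Algebra ℂ R]

/-- The entry of `A ^ k * X`, where `X` is the generic matrix. -/
def halfWord (a : Matrix ι ι R) (k : ℕ) (p j : ι) : MvPolynomial (ι × ι) ℂ ⊗[ℂ] R :=
  ∑ q, coeffC (ι × ι) R ((a ^ k) p q) * coeffX R (q, j)

/-- The entry of `Xᵀ * A ^ k * X`, where `X` is the generic matrix. -/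
def word (a : Matrix ι ι R) (k : ℕ) (i j : ι) : MvPolynomial (ι × ι) ℂ ⊗[ℂ] R :=
  ∑ p, coeffX R (p, i) * halfWord a k p j

/-- The span of the words. -/
def wordSpan (a : Matrix ι ι R) : Submodule ℂ (MvPolynomial (ι × ι) ℂ ⊗[ℂ] R) :=
  Submodule.span ℂ {w | ∃ k i j, w = word a (k + 1) i j}

/-- The subalgebra generated by the traces of the positive powers. -/
def traceAlgebra (a : Matrix ι ι R) : Subalgebra ℂ R :=
  Algebra.adjoin ℂ {r | ∃ k, r = (a ^ (k + 1)).trace}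

theorem coeffPderiv_halfWord (a : Matrix ι ι R) (k : ℕ) (p i q j : ι) :
    coeffPderiv R (p, i) (halfWord a k q j)
      = if i = j then coeffC (ι × ι) R ((a ^ k) q p) else 0 := by
  simp only [halfWord, map_sum, coeffPderiv_mul, coeffPderiv_coeffC, zero_mul, zero_add,
    coeffPderiv_coeffX, Prod.mk.injEq, mul_ite, mul_one, mul_zero, ite_and]
  rw [Finset.sum_ite_eq' Finset.univ p]
  simp [eq_comm]

theorem coeffPderiv_word (a : Matrix ι ι R) (l : ℕ) (p i i' j' : ι) :
    coeffPderiv R (p, i) (word a l i' j')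
      = (if i = i' then halfWord a l p j' else 0) +
        if i = j' then ∑ r, coeffX R (r, i') * coeffC (ι × ι) R ((a ^ l) r p) else 0 := by
  simp only [word, map_sum, coeffPderiv_mul, coeffPderiv_halfWord, coeffPderiv_coeffX,
    Finset.sum_add_distrib, Prod.mk.injEq, ite_mul, one_mul, zero_mul, mul_ite, mul_zero, ite_and]
  congr 1
  · rw [Finset.sum_ite_eq' Finset.univ p]
    simp [eq_comm]
  · split_ifs <;> simp

variable {a : Matrix ι ι R}

omit [Fintype ι] [DecidableEq ι] in
theorem coeffC_neg_one_pow_mul {σ : Type*} (m : ℕ) (x : R) :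
    coeffC σ R ((-1) ^ m * x) = ((-1 : ℂ) ^ m) • coeffC σ R x := by
  rw [← map_smul, Algebra.smul_def]
  simp

/-- With the free index moved to the right end of `A ^ k`, a half-word can be glued to another
half-word sharing that index. -/
theorem halfWord_eq_transpose (hT : ∀ i j, a j i = -a i j)
    (hA : ∀ i j k l, a i j * a k l = -(a k l * a i j)) (k : ℕ) (p j : ι) :
    halfWord a k p j = ((-1 : ℂ) ^ (k * (k + 1) / 2)) •
      ∑ r, coeffX R (r, j) * coeffC (ι × ι) R ((a ^ k) r p) := by
  rw [halfWord, Finset.smul_sum]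
  refine Finset.sum_congr rfl fun q _ => ?_
  rw [pow_entry_transpose hT hA k q p, coeffC_neg_one_pow_mul, coeffX_comm, smul_mul_assoc]

theorem sum_rowWord_mul_halfWord (k l : ℕ) (i j : ι) :
    ∑ p, (∑ r, coeffX R (r, i) * coeffC (ι × ι) R ((a ^ k) r p)) * halfWord a l p j
      = word a (k + l) i j := by
  simp_rw [Finset.sum_mul]
  rw [Finset.sum_comm, word]
  refine Finset.sum_congr rfl fun r _ => ?_
  simp_rw [mul_assoc]
  rw [← Finset.mul_sum]
  congr 1
  simp_rw [halfWord, Finset.mul_sum]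
  rw [Finset.sum_comm]
  refine Finset.sum_congr rfl fun q _ => ?_
  simp_rw [← mul_assoc, ← map_mul]
  rw [← Finset.sum_mul, ← map_sum, ← Matrix.mul_apply, ← pow_add]

theorem coeffC_mul_coeffX_comm (k l : ℕ) (hA : ∀ i j k l, a i j * a k l = -(a k l * a i j))
    (p q r s : ι) (x y : ι × ι) :
    (coeffC (ι × ι) R ((a ^ k) p q) * coeffX R x) * (coeffC (ι × ι) R ((a ^ l) r s) * coeffX R y)
      = ((-1 : ℂ) ^ (k * l)) • ((coeffC (ι × ι) R ((a ^ l) r s) * coeffX R y) *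
        (coeffC (ι × ι) R ((a ^ k) p q) * coeffX R x)) := by
  have h : ∀ u v : R, (coeffC (ι × ι) R u * coeffX R x) * (coeffC (ι × ι) R v * coeffX R y)
      = coeffC (ι × ι) R (u * v) * (coeffX R x * coeffX R y) := by
    intro u v
    rw [mul_assoc, ← mul_assoc (coeffX R x), coeffX_comm x, map_mul]
    simp only [mul_assoc]
  have h' : ∀ u v : R, (coeffC (ι × ι) R u * coeffX R y) * (coeffC (ι × ι) R v * coeffX R x)
      = coeffC (ι × ι) R (u * v) * (coeffX R x * coeffX R y) := by
    intro u v
    rw [mul_assoc, ← mul_assoc (coeffX R y), coeffX_comm y, map_mul, coeffX_comm x (coeffX R y)]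
    simp only [mul_assoc]
  rw [h, h', pow_entry_mul_pow_entry hA, coeffC_neg_one_pow_mul, smul_mul_assoc]

theorem halfWord_mul_rowWord (hA : ∀ i j k l, a i j * a k l = -(a k l * a i j))
    (k l : ℕ) (p i j : ι) :
    halfWord a k p j * (∑ r, coeffX R (r, i) * coeffC (ι × ι) R ((a ^ l) r p))
      = ((-1 : ℂ) ^ (k * l)) •
        ((∑ r, coeffX R (r, i) * coeffC (ι × ι) R ((a ^ l) r p)) * halfWord a k p j) := by
  simp_rw [coeffX_comm]
  rw [halfWord, Finset.sum_mul_sum, Finset.sum_mul_sum, Finset.sum_comm, Finset.smul_sum]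
  refine Finset.sum_congr rfl fun q _ => ?_
  rw [Finset.smul_sum]
  exact Finset.sum_congr rfl fun r _ => coeffC_mul_coeffX_comm k l hA _ _ _ _ _ _

theorem halfWord_mul_word (hA : ∀ i j k l, a i j * a k l = -(a k l * a i j))
    (k l : ℕ) (p j i' j' : ι) :
    halfWord a k p j * word a l i' j'
      = ((-1 : ℂ) ^ (k * l)) • (word a l i' j' * halfWord a k p j) := by
  have h : word a l i' j' = ∑ r, ∑ q, coeffX R (r, i') *
      (coeffC (ι × ι) R ((a ^ l) r q) * coeffX R (q, j')) := by
    simp_rw [word, halfWord, Finset.mul_sum]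
  rw [h, halfWord, Finset.sum_mul_sum, Finset.sum_mul_sum, Finset.sum_comm, Finset.smul_sum]
  refine Finset.sum_congr rfl fun r _ => ?_
  rw [Finset.smul_sum]
  refine Finset.sum_congr rfl fun q _ => ?_
  rw [Finset.mul_sum, Finset.sum_mul, Finset.smul_sum]
  refine Finset.sum_congr rfl fun s _ => ?_
  rw [← mul_assoc, ← coeffX_comm, mul_assoc, coeffC_mul_coeffX_comm k l hA, mul_smul_comm]
  simp only [mul_assoc]

theorem wordSpan_pow_succ (r : ℕ) : wordSpan a ^ (r + 1) = wordSpan a * wordSpan a ^ r := by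
  cases r with
  | zero => rw [Submodule.pow_succ, Submodule.pow_zero, Submodule.one_mul, Submodule.mul_one]
  | succ r => exact Submodule.pow_succ' (wordSpan a) r.succ_ne_zero

theorem word_mem_wordSpan {k : ℕ} (hk : k ≠ 0) (i j : ι) : word a k i j ∈ wordSpan a := by
  obtain ⟨l, rfl⟩ := Nat.exists_eq_succ_of_ne_zero hk
  exact Submodule.subset_span ⟨l, i, j, rfl⟩

/-- The derivative removes one of the two outer entries of the second word; gluing there gives, up
to sign, a single word with power `k + l`. -/
theorem sum_halfWord_mul_pderiv_word_mem (hT : ∀ i j, a j i = -a i j)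
    (hA : ∀ i j k l, a i j * a k l = -(a k l * a i j)) {k l : ℕ} (hk : k ≠ 0)
    (i j i' j' : ι) :
    ∑ p, halfWord a k p j * coeffPderiv R (p, i) (word a l i' j') ∈ wordSpan a := by
  simp_rw [coeffPderiv_word, mul_add, Finset.sum_add_distrib]
  refine add_mem ?_ ?_
  · split_ifs
    · simp_rw [halfWord_eq_transpose hT hA k, smul_mul_assoc]
      rw [← Finset.smul_sum, sum_rowWord_mul_halfWord]
      exact Submodule.smul_mem _ _ (word_mem_wordSpan (by omega) _ _)
    · simp
  · split_ifs
    · simp_rw [halfWord_mul_rowWord hA]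
      rw [← Finset.smul_sum, sum_rowWord_mul_halfWord]
      exact Submodule.smul_mem _ _ (word_mem_wordSpan (by omega) _ _)
    · simp

/-- By the Leibniz rule the half-word is absorbed into one of the `r` factors, after commuting past
the others up to sign. The number of words does not grow. -/
theorem sum_halfWord_mul_pderiv_mem (hT : ∀ i j, a j i = -a i j)
    (hA : ∀ i j k l, a i j * a k l = -(a k l * a i j)) {k : ℕ} (hk : k ≠ 0)
    (i j : ι) (r : ℕ) {y : MvPolynomial (ι × ι) ℂ ⊗[ℂ] R} (hy : y ∈ wordSpan a ^ r) :
    ∑ p, halfWord a k p j * coeffPderiv R (p, i) y ∈ wordSpan a ^ r := by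
  induction r generalizing y with
  | zero =>
    rw [Submodule.pow_zero, Submodule.mem_one] at hy
    obtain ⟨c, rfl⟩ := hy
    rw [← AlgHom.commutes (coeffC (ι × ι) R) c]
    simp_rw [coeffPderiv_coeffC, mul_zero, Finset.sum_const_zero]
    exact zero_mem _
  | succ r ih =>
    rw [wordSpan_pow_succ] at hy ⊢
    refine Submodule.mul_induction_on hy (fun w hw y hy => ?_) (fun x y hx hy => ?_)
    · simp_rw [coeffPderiv_mul, mul_add, Finset.sum_add_distrib]
      refine add_mem ?_ ?_
      · simp_rw [← mul_assoc]
        rw [← Finset.sum_mul]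
        refine Submodule.mul_mem_mul ?_ hy
        refine Submodule.span_induction ?_ ?_ ?_ ?_ hw
        · rintro _ ⟨l, i', j', rfl⟩
          exact sum_halfWord_mul_pderiv_word_mem hT hA hk _ _ _ _
        · simp
        · intro x y _ _ hx hy
          simpa [mul_add, Finset.sum_add_distrib] using add_mem hx hy
        · intro c x _ hx
          simp_rw [map_smul, mul_smul_comm]
          rw [← Finset.smul_sum]
          exact Submodule.smul_mem _ c hx
      · refine Submodule.span_induction ?_ ?_ ?_ ?_ hw
        · rintro _ ⟨l, i', j', rfl⟩
          simp_rw [← mul_assoc, halfWord_mul_word hA, smul_mul_assoc, mul_assoc]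
          rw [← Finset.smul_sum, ← Finset.mul_sum]
          exact Submodule.smul_mem _ _
            (Submodule.mul_mem_mul (word_mem_wordSpan (by omega) _ _) (ih hy))
        · simp
        · intro x y _ _ hx hy
          simpa [mul_add, add_mul, Finset.sum_add_distrib] using add_mem hx hy
        · intro c x _ hx
          simp_rw [smul_mul_assoc, mul_smul_comm]
          rw [← Finset.smul_sum]
          exact Submodule.smul_mem _ c hx
    · simpa [mul_add, Finset.sum_add_distrib] using add_mem hx hy

/-- The Gaussian expectation of a product of words lies in the algebra generated by the traces. -/
theorem coeffExpectation_mem_traceAlgebra (hT : ∀ i j, a j i = -a i j)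
    (hA : ∀ i j k l, a i j * a k l = -(a k l * a i j)) (r : ℕ)
    {y : MvPolynomial (ι × ι) ℂ ⊗[ℂ] R} (hy : y ∈ wordSpan a ^ r) :
    coeffExpectation (ι × ι) R y ∈ traceAlgebra a := by
  induction r generalizing y with
  | zero =>
    rw [Submodule.pow_zero, Submodule.mem_one] at hy
    obtain ⟨c, rfl⟩ := hy
    rw [Algebra.algebraMap_eq_smul_one, map_smul, coeffExpectation_one]
    exact Subalgebra.smul_mem _ (one_mem _) c
  | succ r ih =>
    rw [wordSpan_pow_succ] at hy
    refine Submodule.mul_induction_on hy (fun w hw y hy => ?_) (fun x y hx hy => ?_)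
    · refine Submodule.span_induction ?_ ?_ ?_ ?_ hw
      · rintro _ ⟨k, i, j, rfl⟩
        rw [word, Finset.sum_mul, map_sum]
        -- Stein's identity strips the leading entry. Its derivative either hits the same word,
        -- closing it into a trace, or hits the other `r` words, which absorb the half-word; either
        -- way one word disappears.
        simp_rw [mul_assoc, coeffExpectation_X_mul, coeffPderiv_mul, map_add]
        rw [Finset.sum_add_distrib, ← map_sum, ← map_sum]
        refine add_mem ?_ (ih (sum_halfWord_mul_pderiv_mem hT hA (Nat.succ_ne_zero k) i j r hy))
        simp_rw [coeffPderiv_halfWord]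
        split_ifs
        · rw [← Finset.sum_mul, ← map_sum, coeffExpectation_C_mul]
          exact mul_mem (Algebra.subset_adjoin ⟨k, rfl⟩) (ih hy)
        · simp
      · simp
      · intro x y _ _ hx hy
        rw [add_mul, map_add]
        exact add_mem hx hy
      · intro c x _ hx
        rw [smul_mul_assoc, map_smul]
        exact Subalgebra.smul_mem _ hx c
    · rw [map_add]
      exact add_mem hx hy

theorem coeffEval_word (x : ι × ι → ℂ) (i j : ι) :
    coeffEval R x (word a 1 i j) = ∑ p, ∑ q, (x (p, i) * x (q, j)) • a p q := by
  simp_rw [word, halfWord, map_sum, map_mul, map_sum, map_mul, coeffEval_coeffX, coeffEval_coeffC,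
    pow_one, Finset.mul_sum, ← Algebra.commutes, ← mul_assoc, ← map_mul, ← Algebra.smul_def]

theorem coeffExpectation_mem_traceAlgebra_of_mem_adjoin (hT : ∀ i j, a j i = -a i j)
    (hA : ∀ i j k l, a i j * a k l = -(a k l * a i j)) {y : MvPolynomial (ι × ι) ℂ ⊗[ℂ] R}
    (hy : y ∈ Algebra.adjoin ℂ {w | ∃ i j, w = word a 1 i j}) :
    coeffExpectation (ι × ι) R y ∈ traceAlgebra a := by
  rw [← Subalgebra.mem_toSubmodule, Algebra.adjoin_eq_span] at hy
  have h : ∀ z ∈ Submonoid.closure {w | ∃ i j, w = word a 1 i j}, ∃ r, z ∈ wordSpan a ^ r := by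
    intro z hz
    induction hz using Submonoid.closure_induction_left with
    | one => exact ⟨0, by rw [Submodule.pow_zero]; exact Submodule.one_le.mp le_rfl⟩
    | mul_left x hx y _ hy =>
      obtain ⟨i, j, rfl⟩ := hx
      obtain ⟨r, hr⟩ := hy
      refine ⟨r + 1, ?_⟩
      rw [wordSpan_pow_succ]
      exact Submodule.mul_mem_mul (word_mem_wordSpan one_ne_zero _ _) hr
  refine Submodule.span_induction ?_ ?_ ?_ ?_ hy
  · intro z hz
    obtain ⟨r, hr⟩ := h z hz
    exact coeffExpectation_mem_traceAlgebra hT hA r hr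
  · simp
  · intro x y _ _ hx hy
    rw [map_add]
    exact add_mem hx hy
  · intro c x _ hx
    rw [map_smul]
    exact Subalgebra.smul_mem _ hx c

end Words

/-! ### Hermitian forms attached to bases -/

section HermitianForm

open Module Set Set.powersetCard

variable {I M : Type*} [AddCommGroup M] [Module ℂ M]

/-- The Hermitian form for which the basis `b` is orthonormal. -/
def basisHermitian [Fintype I] (b : Basis I ℂ M) (x y : M) : ℂ :=
  ∑ i, star (b.repr x i) * b.repr y i

/-- The linear maps `f` and `f'` have conjugate transpose matrices in the basis `b`. -/
def IsBasisAdjoint (b : Basis I ℂ M) (f f' : M →ₗ[ℂ] M) : Prop :=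
  ∀ i j, b.repr (f (b i)) j = star (b.repr (f' (b j)) i)

theorem basisHermitian_self_re [Fintype I] (b : Basis I ℂ M) (x : M) :
    (basisHermitian b x x).re = ∑ i, Complex.normSq (b.repr x i) := by
  rw [basisHermitian, Complex.re_sum]
  refine Finset.sum_congr rfl fun i _ => ?_
  rw [Complex.star_def, ← Complex.normSq_eq_conj_mul_self, Complex.ofReal_re]

theorem basisHermitian_self_re_nonneg [Fintype I] (b : Basis I ℂ M) (x : M) :
    0 ≤ (basisHermitian b x x).re := by
  rw [basisHermitian_self_re]
  exact Finset.sum_nonneg fun i _ => Complex.normSq_nonneg _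

theorem basisHermitian_self_re_pos [Fintype I] (b : Basis I ℂ M) {x : M} (hx : x ≠ 0) :
    0 < (basisHermitian b x x).re := by
  rw [basisHermitian_self_re]
  obtain ⟨i, hi⟩ : ∃ i, b.repr x i ≠ 0 := by
    by_contra! h
    exact hx (b.ext_elem fun i => by simp [h i])
  exact Finset.sum_pos' (fun i _ => Complex.normSq_nonneg _)
    ⟨i, Finset.mem_univ i, Complex.normSq_pos.mpr hi⟩

/-- The Hermitian form against a fixed vector as a linear functional. -/
def basisHermitianLeft [Fintype I] (b : Basis I ℂ M) (x : M) : M →ₗ[ℂ] ℂ :=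
  ∑ i, star (b.repr x i) • b.coord i

theorem basisHermitianLeft_apply [Fintype I] (b : Basis I ℂ M) (x y : M) :
    basisHermitianLeft b x y = basisHermitian b x y := by
  simp [basisHermitianLeft, basisHermitian]

theorem IsBasisAdjoint.basisHermitian_eq [Fintype I] {b : Basis I ℂ M} {f f' : M →ₗ[ℂ] M}
    (h : IsBasisAdjoint b f f') (x y : M) :
    basisHermitian b x (f y) = basisHermitian b (f' x) y := by
  have h1 : ∀ (g : M →ₗ[ℂ] M) (z : M) (j : I),
      b.repr (g z) j = ∑ i, b.repr z i * b.repr (g (b i)) j := by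
    intro g z j
    conv_lhs => rw [← b.sum_repr z]
    simp only [map_sum, map_smul, Finsupp.coe_finsetSum, Finset.sum_apply, Finsupp.smul_apply,
      smul_eq_mul]
  simp_rw [basisHermitian, h1 f y, h1 f' x, star_sum, Finset.mul_sum, Finset.sum_mul]
  rw [Finset.sum_comm]
  refine Finset.sum_congr rfl fun i _ => Finset.sum_congr rfl fun j _ => ?_
  rw [h i j, star_mul']
  ring

theorem IsBasisAdjoint.reindex {J : Type*} {b : Basis I ℂ M} {f f' : M →ₗ[ℂ] M}
    (h : IsBasisAdjoint b f f') (ε : I ≃ J) : IsBasisAdjoint (b.reindex ε) f f' := by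
  intro i j
  simpa using h (ε.symm i) (ε.symm j)

/-- The matrix entries of an exterior power are minors, and the determinant turns conjugate
transposition into conjugation. -/
theorem IsBasisAdjoint.exteriorPower [LinearOrder I] {b : Basis I ℂ M} {f f' : M →ₗ[ℂ] M}
    (h : IsBasisAdjoint b f f') (k : ℕ) :
    IsBasisAdjoint (b.exteriorPower k) (exteriorPower.map k f) (exteriorPower.map k f') := by
  intro s t
  simp only [exteriorPower.basis_repr_apply, exteriorPower.basis_apply,
    exteriorPower.ιMulti_family, exteriorPower.map_apply_ιMulti,
    exteriorPower.ιMultiDual_apply_ιMulti]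
  rw [← Matrix.det_conjTranspose]
  congr 1
  ext i j
  simpa using h _ _

theorem exteriorAlgebraBasis_repr_coe [LinearOrder I] (b : Basis I ℂ M) (k : ℕ) (z : ⋀[ℂ]^k M) :
    b.ExteriorAlgebra.repr (z : ExteriorAlgebra ℂ M)
      = ((b.exteriorPower k).repr z).mapDomain Subtype.val := by
  have h : b.ExteriorAlgebra.repr.toLinearMap ∘ₗ (⋀[ℂ]^k M).subtype
      = Finsupp.lmapDomain ℂ ℂ (Subtype.val : powersetCard I k → Finset I) ∘ₗ
        (b.exteriorPower k).repr.toLinearMap := by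
    refine (b.exteriorPower k).ext fun s => ?_
    simp only [LinearMap.comp_apply, Submodule.subtype_apply, LinearEquiv.coe_coe,
      Basis.repr_self, Finsupp.lmapDomain_apply, Finsupp.mapDomain_single]
    rw [← ExteriorAlgebra.basis_eq_coe_basis, Basis.repr_self]
  exact LinearMap.congr_fun h z

theorem exteriorAlgebra_map_coe {N : Type*} [AddCommGroup N] [Module ℂ N] (f : M →ₗ[ℂ] N) (k : ℕ)
    (z : ⋀[ℂ]^k M) :
    ExteriorAlgebra.map f (z : ExteriorAlgebra ℂ M)
      = (exteriorPower.map k f z : ⋀[ℂ]^k N) := by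
  have h : (ExteriorAlgebra.map f).toLinearMap ∘ₗ (⋀[ℂ]^k M).subtype
      = (⋀[ℂ]^k N).subtype ∘ₗ exteriorPower.map k f := by
    refine exteriorPower.linearMap_ext ?_
    ext v
    simp
  exact LinearMap.congr_fun h z

theorem IsBasisAdjoint.exteriorAlgebra [LinearOrder I] {b : Basis I ℂ M} {f f' : M →ₗ[ℂ] M}
    (h : IsBasisAdjoint b f f') :
    IsBasisAdjoint b.ExteriorAlgebra (ExteriorAlgebra.map f).toLinearMap
      (ExteriorAlgebra.map f').toLinearMap := by
  have key : ∀ (g : M →ₗ[ℂ] M) (k : ℕ) (s : powersetCard I k) (t : Finset I),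
      b.ExteriorAlgebra.repr ((ExteriorAlgebra.map g).toLinearMap (b.ExteriorAlgebra s)) t
        = ((b.exteriorPower k).repr (exteriorPower.map k g (b.exteriorPower k s))).mapDomain
          Subtype.val t := by
    intro g k s t
    rw [ExteriorAlgebra.basis_eq_coe_basis, AlgHom.toLinearMap_apply, exteriorAlgebra_map_coe,
      exteriorAlgebraBasis_repr_coe]
  intro s t
  by_cases hst : t.card = s.card
  · obtain ⟨k, hs⟩ : ∃ k, s.card = k := ⟨_, rfl⟩
    have h1 := key f k ⟨s, hs⟩ (⟨t, hst.trans hs⟩ : powersetCard I k)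
    have h2 := key f' k ⟨t, hst.trans hs⟩ (⟨s, hs⟩ : powersetCard I k)
    rw [Finsupp.mapDomain_apply Subtype.val_injective] at h1 h2
    refine h1.trans ?_
    rw [h.exteriorPower k]
    exact congrArg star h2.symm
  -- The maps preserve degree, so entries between different degrees vanish on both sides.
  · have h1 := key f _ ⟨s, rfl⟩ t
    have h2 := key f' _ ⟨t, rfl⟩ s
    rw [Finsupp.mapDomain_of_notMem_range] at h1 h2
    · refine h1.trans ?_
      rw [← star_zero]
      exact congrArg star h2.symm
    · rintro ⟨u, hu⟩
      exact hst (by rw [← hu]; exact u.2.symm)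
    · rintro ⟨u, hu⟩
      exact hst (by rw [← hu]; exact u.2)

end HermitianForm

/-! ### The action of matrices -/

section MatrixAction

open Module

variable {V : Type*} [AddCommGroup V] [Module ℂ V] {n : ℕ}

theorem lambdaTwoAction_comp (f g : V →ₗ[ℂ] V) (x : ExtAlgLambdaTwo V) :
    lambdaTwoAction (f ∘ₗ g) x = lambdaTwoAction f (lambdaTwoAction g x) := by
  rw [lambdaTwoAction, lambdaTwoAction, lambdaTwoAction, exteriorPower.map_comp,
    ← ExteriorAlgebra.map_comp_map]
  rfl

theorem lambdaTwoAction_id (x : ExtAlgLambdaTwo V) : lambdaTwoAction LinearMap.id x = x := by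
  rw [lambdaTwoAction, exteriorPower.map_id, ExteriorAlgebra.map_id]
  rfl

/-- The action of a matrix on `Λ(Λ₂(V))` through a basis of `V`. -/
def matrixAction (e : Basis (Fin n) ℂ V) (G : Matrix (Fin n) (Fin n) ℂ) :
    ExtAlgLambdaTwo V →ₐ[ℂ] ExtAlgLambdaTwo V :=
  lambdaTwoAction (Matrix.toLin e e G)

theorem matrixAction_mul (e : Basis (Fin n) ℂ V) (G H : Matrix (Fin n) (Fin n) ℂ)
    (x : ExtAlgLambdaTwo V) :
    matrixAction e (G * H) x = matrixAction e G (matrixAction e H x) := by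
  rw [matrixAction, Matrix.toLin_mul e e e, lambdaTwoAction_comp]
  rfl

theorem matrixAction_one (e : Basis (Fin n) ℂ V) (x : ExtAlgLambdaTwo V) :
    matrixAction e 1 x = x := by
  rw [matrixAction, Matrix.toLin_one, lambdaTwoAction_id]

theorem matrixA_apply (e : Fin n → V) (i j : Fin n) :
    matrixA e i j = ExteriorAlgebra.ι ℂ (exteriorPower.ιMulti ℂ 2 ![e i, e j]) := rfl

theorem matrixA_transpose (e : Fin n → V) (i j : Fin n) : matrixA e j i = -matrixA e i j := by
  have h := (exteriorPower.ιMulti ℂ 2).map_swap ![e i, e j] (i := 0) (j := 1) (by simp)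
  rw [matrixA_apply, matrixA_apply, ← map_neg, ← h]
  congr 2

theorem ι_mul_ι_comm {M : Type*} [AddCommGroup M] [Module ℂ M] (x y : M) :
    ExteriorAlgebra.ι ℂ x * ExteriorAlgebra.ι ℂ y
      = -(ExteriorAlgebra.ι ℂ y * ExteriorAlgebra.ι ℂ x) :=
  eq_neg_of_add_eq_zero_left (ExteriorAlgebra.ι_add_mul_swap x y)

theorem matrixA_anticomm (e : Fin n → V) (i j k l : Fin n) :
    matrixA e i j * matrixA e k l = -(matrixA e k l * matrixA e i j) :=
  ι_mul_ι_comm _ _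

/-- `Λ₂` of a linear combination. -/
theorem ιMulti_two_sum {κ : Type*} [Fintype κ] (v : κ → V) (c d : κ → ℂ) :
    exteriorPower.ιMulti ℂ 2 ![∑ p, c p • v p, ∑ q, d q • v q]
      = ∑ p, ∑ q, (c p * d q) • exteriorPower.ιMulti ℂ 2 ![v p, v q] := by
  have hu0 : ∀ x y z : V, Function.update ![x, z] 0 y = ![y, z] := by
    intro x y z
    ext k
    fin_cases k <;> rfl
  have hu1 : ∀ x y z : V, Function.update ![z, x] 1 y = ![z, y] := by
    intro x y z
    ext k
    fin_cases k <;> rfl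
  have h0 : ∀ (x y z : V), exteriorPower.ιMulti ℂ 2 ![x + y, z]
      = exteriorPower.ιMulti ℂ 2 ![x, z] + exteriorPower.ιMulti ℂ 2 ![y, z] := by
    intro x y z
    have := (exteriorPower.ιMulti ℂ 2).map_update_add ![x, z] 0 x y
    simpa only [hu0, hu1] using this
  have h1 : ∀ (x y z : V), exteriorPower.ιMulti ℂ 2 ![z, x + y]
      = exteriorPower.ιMulti ℂ 2 ![z, x] + exteriorPower.ιMulti ℂ 2 ![z, y] := by
    intro x y z
    have := (exteriorPower.ιMulti ℂ 2).map_update_add ![z, x] 1 x y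
    simpa only [hu0, hu1] using this
  have h2 : ∀ (c : ℂ) (x z : V), exteriorPower.ιMulti ℂ 2 ![c • x, z]
      = c • exteriorPower.ιMulti ℂ 2 ![x, z] := by
    intro c x z
    have := (exteriorPower.ιMulti ℂ 2).map_update_smul ![x, z] 0 c x
    simpa only [hu0, hu1] using this
  have h3 : ∀ (c : ℂ) (x z : V), exteriorPower.ιMulti ℂ 2 ![z, c • x]
      = c • exteriorPower.ιMulti ℂ 2 ![z, x] := by
    intro c x z
    have := (exteriorPower.ιMulti ℂ 2).map_update_smul ![z, x] 1 c x
    simpa only [hu0, hu1] using this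
  let L : V →ₗ[ℂ] V →ₗ[ℂ] ⋀[ℂ]^2 V :=
    LinearMap.mk₂ ℂ (fun x y => exteriorPower.ιMulti ℂ 2 ![x, y])
      (fun x y z => h0 x y z) (fun c x z => h2 c x z) (fun z x y => h1 x y z)
      (fun c z x => h3 c x z)
  change L _ _ = ∑ p, ∑ q, (c p * d q) • L (v p) (v q)
  simp only [map_sum, LinearMap.sum_apply, map_smul, LinearMap.smul_apply, Finset.smul_sum,
    mul_smul]
  rw [Finset.sum_comm]
  exact Finset.sum_congr rfl fun p _ => Finset.sum_congr rfl fun q _ => smul_comm _ _ _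

theorem lambdaTwoAction_matrixA (f : V →ₗ[ℂ] V) (e : Fin n → V) (i j : Fin n) :
    lambdaTwoAction f (matrixA e i j) = matrixA (fun k => f (e k)) i j := by
  rw [matrixA_apply, matrixA_apply, lambdaTwoAction, ExteriorAlgebra.map_apply_ι,
    exteriorPower.map_apply_ιMulti]
  congr 2

/-- This is `A ↦ Gᵀ A G`, which matches the evaluation of words in `coeffEval_word`. -/
theorem matrixAction_matrixA (e : Basis (Fin n) ℂ V) (G : Matrix (Fin n) (Fin n) ℂ)
    (i j : Fin n) :
    matrixAction e G (matrixA e i j) = ∑ p, ∑ q, (G p i * G q j) • matrixA e p q := by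
  rw [matrixAction, lambdaTwoAction_matrixA, matrixA_apply]
  simp_rw [Matrix.toLin_self]
  rw [ιMulti_two_sum]
  simp [matrixA_apply]

theorem adjoin_matrixA (e : Basis (Fin n) ℂ V) :
    Algebra.adjoin ℂ {w | ∃ i j, w = matrixA e i j} = ⊤ := by
  rw [eq_top_iff]
  rintro x -
  induction x using ExteriorAlgebra.induction with
  | algebraMap r => exact Subalgebra.algebraMap_mem _ r
  | ι x =>
    have hx : x ∈ Submodule.span ℂ (Set.range (e.exteriorPower 2)) := by
      rw [Basis.span_eq]
      trivial
    refine Submodule.span_induction ?_ ?_ ?_ ?_ hx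
    · rintro _ ⟨s, rfl⟩
      refine Algebra.subset_adjoin ⟨Set.powersetCard.ofFinEmbEquiv.symm s 0,
        Set.powersetCard.ofFinEmbEquiv.symm s 1, ?_⟩
      rw [exteriorPower.basis_apply, exteriorPower.ιMulti_family, matrixA_apply]
      congr 2
    · simp
    · intro x y _ _ hx hy
      rw [map_add]
      exact add_mem hx hy
    · intro c x _ hx
      rw [map_smul]
      exact Subalgebra.smul_mem _ hx c
  | mul a b ha hb => exact mul_mem ha hb
  | add a b ha hb => exact add_mem ha hb

/-- The basis of `Λ₂(V)` attached to a basis of `V`. -/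
def lambdaTwoBasis (e : Basis (Fin n) ℂ V) :
    Basis (Fin (Fintype.card (Set.powersetCard (Fin n) 2))) ℂ (⋀[ℂ]^2 V) :=
  (e.exteriorPower 2).reindex (Fintype.equivFin _)

/-- The basis of `Λ(Λ₂(V))` attached to a basis of `V`. -/
def extAlgBasis (e : Basis (Fin n) ℂ V) :
    Basis (Finset (Fin (Fintype.card (Set.powersetCard (Fin n) 2)))) ℂ (ExtAlgLambdaTwo V) :=
  (lambdaTwoBasis e).ExteriorAlgebra

theorem isBasisAdjoint_matrixAction (e : Basis (Fin n) ℂ V) (G : Matrix (Fin n) (Fin n) ℂ) :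
    IsBasisAdjoint (extAlgBasis e) (matrixAction e G).toLinearMap
      (matrixAction e G.conjTranspose).toLinearMap := by
  refine IsBasisAdjoint.exteriorAlgebra ?_
  refine IsBasisAdjoint.reindex ?_ _
  refine IsBasisAdjoint.exteriorPower ?_ 2
  intro i j
  simp [Matrix.toLin_self, Finsupp.single_apply]

theorem basisHermitian_matrixAction (e : Basis (Fin n) ℂ V) (G : Matrix (Fin n) (Fin n) ℂ)
    (x y : ExtAlgLambdaTwo V) :
    basisHermitian (extAlgBasis e) x (matrixAction e G y)
      = basisHermitian (extAlgBasis e) (matrixAction e G.conjTranspose x) y :=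
  (isBasisAdjoint_matrixAction e G).basisHermitian_eq x y

end MatrixAction

/-! ### Averaging over Gaussian matrices -/

section Averaging

open Module TensorProduct

variable {V : Type*} [AddCommGroup V] [Module ℂ V] {n : ℕ}

/-- Action and evaluation are algebra homomorphisms, so a polynomial in the `a_ij` lifts to the same
polynomial in the words `Xᵀ A X`. -/
theorem exists_generic_action (e : Basis (Fin n) ℂ V) (x : ExtAlgLambdaTwo V) :
    ∃ F ∈ Algebra.adjoin ℂ {w | ∃ i j, w = word (matrixA e) 1 i j},
      ∀ y : Fin n × Fin n → ℂ, coeffEval _ y F = matrixAction e (Matrix.of fun i j => y (i, j)) x := by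
  have hx : x ∈ Algebra.adjoin ℂ {w | ∃ i j, w = matrixA e i j} := by
    rw [adjoin_matrixA]
    trivial
  induction hx using Algebra.adjoin_induction with
  | mem x hx =>
    obtain ⟨i, j, rfl⟩ := hx
    refine ⟨word (matrixA e) 1 i j, Algebra.subset_adjoin ⟨i, j, rfl⟩, fun y => ?_⟩
    rw [coeffEval_word, matrixAction_matrixA]
    rfl
  | algebraMap r =>
    exact ⟨algebraMap ℂ _ r, Subalgebra.algebraMap_mem _ r, fun y => by simp only [AlgHom.commutes]⟩
  | add x z _ _ hx hz =>
    obtain ⟨F, hF, hF'⟩ := hx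
    obtain ⟨H, hH, hH'⟩ := hz
    exact ⟨F + H, add_mem hF hH, fun y => by rw [map_add, map_add, hF', hH']⟩
  | mul x z _ _ hx hz =>
    obtain ⟨F, hF, hF'⟩ := hx
    obtain ⟨H, hH, hH'⟩ := hz
    exact ⟨F * H, mul_mem hF hH, fun y => by rw [map_mul, map_mul, hF', hH']⟩

/-- The average of the action of a Gaussian matrix has values in the algebra generated by traces. -/
theorem exists_gaussian_average (e : Basis (Fin n) ℂ V) :
    ∃ W : ExtAlgLambdaTwo V →ₗ[ℂ] ExtAlgLambdaTwo V,
      (∀ x, W x ∈ traceAlgebra (matrixA e)) ∧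
      ∀ (l : ExtAlgLambdaTwo V →ₗ[ℂ] ℂ) (x : ExtAlgLambdaTwo V),
        ∃ f : MvPolynomial (Fin n × Fin n) ℂ, gaussianExpectation _ f = l (W x) ∧
          ∀ y : Fin n × Fin n → ℂ,
            MvPolynomial.eval y f = l (matrixAction e (Matrix.of fun i j => y (i, j)) x) := by
  choose F hF hF' using exists_generic_action e
  -- The chosen lifts `F x` need not be linear in `x`; keeping them only on a basis and extending
  -- linearly repairs this.
  let Φ : ExtAlgLambdaTwo V →ₗ[ℂ] (MvPolynomial (Fin n × Fin n) ℂ ⊗[ℂ] ExtAlgLambdaTwo V) :=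
    (extAlgBasis e).constr ℂ fun s => F (extAlgBasis e s)
  have hΦ : ∀ x, Φ x ∈ Algebra.adjoin ℂ {w | ∃ i j, w = word (matrixA e) 1 i j} := by
    intro x
    rw [Basis.constr_apply_fintype]
    exact sum_mem fun s _ => Subalgebra.smul_mem _ (hF _) _
  have hΦ' : ∀ (y : Fin n × Fin n → ℂ) (x : ExtAlgLambdaTwo V),
      coeffEval _ y (Φ x) = matrixAction e (Matrix.of fun i j => y (i, j)) x := by
    intro y
    have h : (coeffEval _ y).toLinearMap ∘ₗ Φ
        = (matrixAction e (Matrix.of fun i j => y (i, j))).toLinearMap := by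
      refine (extAlgBasis e).ext fun s => ?_
      rw [LinearMap.comp_apply, Basis.constr_basis]
      exact hF' _ y
    exact LinearMap.congr_fun h
  refine ⟨coeffExpectation _ _ ∘ₗ Φ, fun x => ?_, fun l x => ?_⟩
  · exact coeffExpectation_mem_traceAlgebra_of_mem_adjoin (matrixA_transpose e)
      (matrixA_anticomm e) (hΦ x)
  · obtain ⟨f, hf, hf'⟩ := exists_gaussianExpectation_eq l (Φ x)
    exact ⟨f, hf, fun y => by rw [hf', hΦ']⟩

end Averaging

/-! ### Polar decomposition of real matrices -/

section Polar

open Matrix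

variable {n : ℕ}

/-- A fourth root is taken because the positive factor of the polar decomposition must itself be a
square `S * S`, so that one `S` can be moved across the Hermitian form. -/
theorem exists_fourth_root {P : Matrix (Fin n) (Fin n) ℝ} (hP : P.PosSemidef) :
    ∃ S : Matrix (Fin n) (Fin n) ℝ, Sᵀ = S ∧ (S * S) * (S * S) = P := by
  have hH := hP.isHermitian
  let U : Matrix (Fin n) (Fin n) ℝ := hH.eigenvectorUnitary
  have hU : star U * U = 1 := Unitary.coe_star_mul_self hH.eigenvectorUnitary
  let D : Matrix (Fin n) (Fin n) ℝ := diagonal fun i => Real.sqrt (Real.sqrt (hH.eigenvalues i))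
  have hD : (D * D) * (D * D) = diagonal hH.eigenvalues := by
    simp only [D, diagonal_mul_diagonal]
    congr 1
    ext i
    rw [Real.mul_self_sqrt (Real.sqrt_nonneg _), Real.mul_self_sqrt (hP.eigenvalues_nonneg i)]
  have hmul : ∀ A B : Matrix (Fin n) (Fin n) ℝ, (U * A * star U) * (U * B * star U)
      = U * (A * B) * star U := by
    intro A B
    calc (U * A * star U) * (U * B * star U) = U * A * (star U * U) * B * star U := by
          simp only [Matrix.mul_assoc]
      _ = _ := by rw [hU, Matrix.mul_one]; simp only [Matrix.mul_assoc]
  refine ⟨U * D * star U, ?_, ?_⟩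
  · rw [transpose_mul, transpose_mul, diagonal_transpose, star_eq_conjTranspose,
      conjTranspose_eq_transpose_of_trivial, transpose_transpose, Matrix.mul_assoc]
  · rw [hmul, hmul, hD]
    conv_rhs => rw [hH.spectral_theorem]
    simp [U, Unitary.conjStarAlgAut_apply]

/-- An invertible real matrix is the product of an orthogonal matrix and the square of a symmetric
matrix. -/
theorem exists_polar {G : Matrix (Fin n) (Fin n) ℝ} (hG : G.det ≠ 0) :
    ∃ O S : Matrix (Fin n) (Fin n) ℝ, Oᵀ * O = 1 ∧ Sᵀ = S ∧ G = O * (S * S) := by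
  have hP : (Gᵀ * G).PosSemidef := by
    have := posSemidef_conjTranspose_mul_self G
    rwa [conjTranspose_eq_transpose_of_trivial] at this
  obtain ⟨S, hS, hS4⟩ := exists_fourth_root hP
  have hdet : IsUnit (S * S).det := by
    rw [isUnit_iff_ne_zero]
    intro h
    have h1 := congrArg det hS4
    rw [det_mul, h, zero_mul, det_mul, det_transpose] at h1
    exact hG (mul_self_eq_zero.mp h1.symm)
  refine ⟨G * (S * S)⁻¹, S, ?_, hS, ?_⟩
  · rw [transpose_mul, transpose_nonsing_inv, transpose_mul, hS]
    calc (S * S)⁻¹ * Gᵀ * (G * (S * S)⁻¹) = (S * S)⁻¹ * (Gᵀ * G) * (S * S)⁻¹ := by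
          simp only [Matrix.mul_assoc]
      _ = ((S * S)⁻¹ * (S * S)) * ((S * S) * (S * S)⁻¹) := by
          rw [← hS4]
          simp only [Matrix.mul_assoc]
      _ = 1 := by rw [nonsing_inv_mul _ hdet, mul_nonsing_inv _ hdet, Matrix.mul_one]
  · rw [Matrix.mul_assoc, nonsing_inv_mul _ hdet, Matrix.mul_one]

/-- A closed condition on real matrices can be checked on invertible matrices. -/
theorem of_forall_det_ne_zero {p : Matrix (Fin n) (Fin n) ℝ → Prop} (hp : IsClosed {G | p G})
    (h : ∀ G, G.det ≠ 0 → p G) (G : Matrix (Fin n) (Fin n) ℝ) : p G := by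
  -- On the line `t + G` the singular matrices occur only at the finitely many roots of the
  -- characteristic polynomial of `-G`, so `t = 0` is a limit of admissible values.
  have hc : IsClosed {t : ℝ | p (Matrix.scalar (Fin n) t - (-G))} := by
    refine hp.preimage (f := fun t : ℝ => Matrix.scalar (Fin n) t - (-G)) ?_
    refine Continuous.sub ?_ continuous_const
    exact Continuous.matrix_diagonal (continuous_pi fun _ => continuous_id)
  have hfin : {t : ℝ | (-G).charpoly.IsRoot t}.Finite :=
    Polynomial.finite_setOfPred_isRoot (charpoly_monic _).ne_zero
  have hd : Dense {t : ℝ | (-G).charpoly.IsRoot t}ᶜ := by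
    rw [Set.compl_eq_univ_sdiff]
    exact dense_univ.sdiff_finite hfin
  have hsub : {t : ℝ | (-G).charpoly.IsRoot t}ᶜ ⊆ {t : ℝ | p (Matrix.scalar (Fin n) t - (-G))} := by
    intro t ht
    refine h _ ?_
    rw [← eval_charpoly]
    exact ht
  have h0 : (0 : ℝ) ∈ {t : ℝ | p (Matrix.scalar (Fin n) t - (-G))} :=
    hc.closure_subset_iff.mpr hsub (hd 0)
  simpa using h0

end Polar

/-! ### Generation of the invariants by traces -/

section Generation

open Module

variable {V : Type*} [AddCommGroup V] [Module ℂ V] {n : ℕ}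

theorem basis_form_apply {B : LinearMap.BilinForm ℂ V} {e : Basis (Fin n) ℂ V}
    (he : ∀ i j, B (e i) (e j) = if i = j then 1 else 0) (v w : V) :
    B v w = ∑ i, e.repr v i * e.repr w i := by
  conv_lhs => rw [← e.sum_repr v, ← e.sum_repr w]
  simp only [map_sum, map_smul, LinearMap.sum_apply, LinearMap.smul_apply, he, smul_eq_mul,
    mul_ite, mul_one, mul_zero, Finset.sum_ite_eq', Finset.mem_univ, if_true]
  exact Finset.sum_congr rfl fun i _ => mul_comm _ _

theorem matrixAction_eq_self_of_mem_invariants {B : LinearMap.BilinForm ℂ V}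
    {e : Basis (Fin n) ℂ V} (he : ∀ i j, B (e i) (e j) = if i = j then 1 else 0)
    {x : ExtAlgLambdaTwo V} (hx : x ∈ orthogonalInvariants B) {O : Matrix (Fin n) (Fin n) ℂ}
    (hO : O.transpose * O = 1) : matrixAction e O x = x := by
  have hO' : O * O.transpose = 1 := mul_eq_one_comm.mp hO
  let g : V ≃ₗ[ℂ] V := Matrix.toLinOfInv e e hO' hO
  have hg : ∀ v, g v = Matrix.toLin e e O v := fun v => rfl
  refine hx g fun v w => ?_
  have h : B.compl₁₂ (Matrix.toLin e e O) (Matrix.toLin e e O) = B := by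
    refine LinearMap.ext_basis e e fun i j => ?_
    rw [LinearMap.compl₁₂_apply, basis_form_apply he, he]
    simp only [Matrix.toLin_self, map_sum, map_smul, Basis.repr_self, Finsupp.coe_finsetSum,
      Finset.sum_apply, Finsupp.smul_apply, smul_eq_mul, Finsupp.single_apply]
    have := congrFun (congrFun hO i) j
    rw [Matrix.mul_apply, Matrix.one_apply] at this
    rw [← this]
    simp
  exact LinearMap.congr_fun₂ h v w

/-- With `G = O S²`: moving `O` to the left gives `Oᵀ x = x`, and moving one `S` leaves `⟨S x, S
x⟩`. -/
theorem hermitian_matrixAction_nonneg {B : LinearMap.BilinForm ℂ V}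
    {e : Basis (Fin n) ℂ V} (he : ∀ i j, B (e i) (e j) = if i = j then 1 else 0)
    {x : ExtAlgLambdaTwo V} (hx : x ∈ orthogonalInvariants B) {G : Matrix (Fin n) (Fin n) ℝ}
    (hG : G.det ≠ 0) :
    0 ≤ (basisHermitian (extAlgBasis e) x (matrixAction e (G.map Complex.ofRealHom) x)).re := by
  obtain ⟨O, S, hO, hS, rfl⟩ := exists_polar hG
  have hct : ∀ A : Matrix (Fin n) (Fin n) ℝ,
      (A.map Complex.ofRealHom).conjTranspose = A.transpose.map Complex.ofRealHom := by
    intro A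
    ext i j
    simp
  have hOt : matrixAction e (O.transpose.map Complex.ofRealHom) x = x := by
    refine matrixAction_eq_self_of_mem_invariants he hx ?_
    rw [← Matrix.transpose_map, ← Matrix.map_mul, Matrix.transpose_transpose,
      mul_eq_one_comm.mp hO]
    simp
  rw [Matrix.map_mul, Matrix.map_mul, matrixAction_mul, basisHermitian_matrixAction, hct, hOt,
    matrixAction_mul, basisHermitian_matrixAction, hct, hS]
  exact basisHermitian_self_re_nonneg _ _

/-- The action replaces `A` by `Oᵀ A O`. The entries of `O` are central, so the trace may be rotated
past `O` although the entries of `A` do not commute. -/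
theorem matrixAction_trace_pow (e : Basis (Fin n) ℂ V) {O : Matrix (Fin n) (Fin n) ℂ}
    (hO : O.transpose * O = 1) (k : ℕ) :
    matrixAction e O ((matrixA e) ^ k).trace = ((matrixA e) ^ k).trace := by
  have hO' : O * O.transpose = 1 := mul_eq_one_comm.mp hO
  let c : ℂ →+* ExtAlgLambdaTwo V := algebraMap ℂ _
  have hc : ∀ (r : ℂ) (x : ExtAlgLambdaTwo V), c r * x = x * c r := Algebra.commutes
  have h1 : (matrixA e).map (matrixAction e O)
      = O.transpose.map c * matrixA e * O.map c := by
    ext i j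
    rw [Matrix.map_apply, matrixAction_matrixA, Matrix.mul_apply, Finset.sum_comm]
    refine Finset.sum_congr rfl fun q _ => ?_
    rw [Matrix.mul_apply, Finset.sum_mul]
    refine Finset.sum_congr rfl fun p _ => ?_
    rw [Matrix.map_apply, Matrix.map_apply, Matrix.transpose_apply, mul_assoc, ← hc,
      ← mul_assoc, ← map_mul, Algebra.smul_def]
  have h2 : O.map c * O.transpose.map c = 1 := by
    rw [← Matrix.map_mul, hO']
    simp
  have h3 : ∀ k, ((matrixA e).map (matrixAction e O)) ^ k * O.transpose.map c
      = O.transpose.map c * (matrixA e) ^ k := by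
    intro k
    induction k with
    | zero => simp
    | succ k ih =>
      have h6 : (matrixA e).map (matrixAction e O) * O.transpose.map c
          = O.transpose.map c * matrixA e := by
        rw [h1, mul_assoc, h2, mul_one]
      rw [pow_succ, mul_assoc, h6, ← mul_assoc, ih, mul_assoc, ← pow_succ]
  have h3' : ((matrixA e).map (matrixAction e O)) ^ k
      = O.transpose.map c * (matrixA e) ^ k * O.map c := by
    rw [← h3, mul_assoc, ← Matrix.map_mul, hO]
    simp
  have h4 : matrixAction e O ((matrixA e) ^ k).trace
      = (((matrixA e).map (matrixAction e O)) ^ k).trace := by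
    have := AddMonoidHom.map_trace (matrixAction e O) ((matrixA e) ^ k)
    rw [this, ← AlgHom.mapMatrix_apply, ← AlgHom.mapMatrix_apply, map_pow]
  rw [h4, h3', Matrix.trace, Matrix.trace]
  simp_rw [Matrix.diag_apply, Matrix.mul_apply]
  have h5 : ∀ p q, ∑ i, c (O p i) * c (O q i) = if p = q then 1 else 0 := by
    intro p q
    have := congrFun (congrFun h2 p) q
    rwa [Matrix.mul_apply, Matrix.one_apply] at this
  calc ∑ i, ∑ q, (∑ p, O.transpose.map c i p * ((matrixA e) ^ k) p q) * O.map c q i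
      = ∑ q, ∑ p, (∑ i, c (O p i) * c (O q i)) * ((matrixA e) ^ k) p q := by
        rw [Finset.sum_comm]
        refine Finset.sum_congr rfl fun q _ => ?_
        simp_rw [Finset.sum_mul]
        rw [Finset.sum_comm]
        refine Finset.sum_congr rfl fun p _ => Finset.sum_congr rfl fun i _ => ?_
        rw [Matrix.map_apply, Matrix.map_apply, Matrix.transpose_apply, mul_assoc, ← hc, mul_assoc]
    _ = _ := by simp [h5]

theorem traceAlgebra_le_invariants {B : LinearMap.BilinForm ℂ V}
    {e : Basis (Fin n) ℂ V} (he : ∀ i j, B (e i) (e j) = if i = j then 1 else 0) :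
    traceAlgebra (matrixA e) ≤ orthogonalInvariants B := by
  refine Algebra.adjoin_le ?_
  rintro _ ⟨k, rfl⟩ g hg
  have h : (g : V →ₗ[ℂ] V) = Matrix.toLin e e (LinearMap.toMatrix e e (g : V →ₗ[ℂ] V)) := by simp
  rw [h]
  refine matrixAction_trace_pow e ?_ (k + 1)
  ext i j
  have := hg (e i) (e j)
  rw [basis_form_apply he, he] at this
  rw [Matrix.mul_apply, Matrix.one_apply, ← this]
  simp [LinearMap.toMatrix_apply]

/-- The invariants are generated by the traces of the powers of the matrix `A`. -/
theorem traceAlgebra_eq_invariants {B : LinearMap.BilinForm ℂ V}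
    {e : Basis (Fin n) ℂ V} (he : ∀ i j, B (e i) (e j) = if i = j then 1 else 0) :
    traceAlgebra (matrixA e) = orthogonalInvariants B := by
  refine le_antisymm (traceAlgebra_le_invariants he) ?_
  obtain ⟨W, hW, hW'⟩ := exists_gaussian_average e
  have hpos : ∀ x ∈ orthogonalInvariants B, x ≠ 0 → W x ≠ 0 := by
    intro x hx hx0 hWx
    obtain ⟨f, hf, hf'⟩ := hW' (basisHermitianLeft (extAlgBasis e) x) x
    have hev : ∀ y : Fin n × Fin n → ℝ, MvPolynomial.eval (fun s => (y s : ℂ)) f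
        = basisHermitian (extAlgBasis e) x
          (matrixAction e ((Matrix.of fun i j => y (i, j)).map Complex.ofRealHom) x) := by
      intro y
      rw [hf', basisHermitianLeft_apply]
      rfl
    have hcont : Continuous fun y : Fin n × Fin n → ℝ =>
        (MvPolynomial.eval (fun s => (y s : ℂ)) f).re := by
      refine Complex.continuous_re.comp ((MvPolynomial.continuous_eval f).comp ?_)
      fun_prop
    -- The polar decomposition covers invertible matrices; the remaining ones follow by closedness.
    have hnn : ∀ G : Matrix (Fin n) (Fin n) ℝ,
        0 ≤ (MvPolynomial.eval (fun s => ((G s.1 s.2 : ℝ) : ℂ)) f).re := by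
      refine of_forall_det_ne_zero ?_ ?_
      · refine isClosed_le continuous_const (hcont.comp (g := fun y : Fin n × Fin n → ℝ =>
          (MvPolynomial.eval (fun s => (y s : ℂ)) f).re)
          (f := fun (G : Matrix (Fin n) (Fin n) ℝ) s => G s.1 s.2) ?_)
        fun_prop
      · intro G hG
        rw [hev fun s => G s.1 s.2]
        exact hermitian_matrixAction_nonneg he hx hG
    have h := gaussianExpectation_re_pos f (fun y => hnn (Matrix.of fun i j => y (i, j)))
      (fun s => (1 : Matrix (Fin n) (Fin n) ℝ) s.1 s.2) (by
        rw [hev fun s => (1 : Matrix (Fin n) (Fin n) ℝ) s.1 s.2]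
        have h1 : ((Matrix.of fun i j => (1 : Matrix (Fin n) (Fin n) ℝ) i j).map
            Complex.ofRealHom) = 1 := by
          ext i j
          simp [Matrix.one_apply]
        rw [h1, matrixAction_one]
        exact basisHermitian_self_re_pos _ hx0)
    rw [hf, hWx] at h
    simp at h
  let I := Subalgebra.toSubmodule (orthogonalInvariants B)
  have hmaps : ∀ x ∈ I, W x ∈ I := fun x _ => traceAlgebra_le_invariants he (hW x)
  have : Module.Finite ℂ (ExtAlgLambdaTwo V) := Module.Finite.of_basis (extAlgBasis e)
  have hinj : Function.Injective (W.restrict hmaps) := by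
    rw [← LinearMap.ker_eq_bot, LinearMap.ker_eq_bot']
    intro x hx
    by_contra hx0
    exact hpos x x.2 (fun h => hx0 (Subtype.ext h)) (congrArg Subtype.val hx)
  intro x hx
  -- By finite dimension, the injective restriction of `W` to the invariants is surjective.
  obtain ⟨y, hy⟩ := LinearMap.injective_iff_surjective.mp hinj ⟨x, hx⟩
  have : W y = x := congrArg Subtype.val hy
  rw [← this]
  exact hW y

end Generation

/-! ### The determinant of a skew-symmetric matrix is a square -/

section Pfaffian

open Matrix

theorem isSquare_det_of_transpose_eq_neg {K : Type*} [Field K] [CharZero K] (N : ℕ) :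
    ∀ {ι : Type*} [Fintype ι] [DecidableEq ι], Fintype.card ι = N →
      ∀ X : Matrix ι ι K, Xᵀ = -X → IsSquare X.det := by
  induction N using Nat.strong_induction_on with
  | _ N ih =>
    intro ι _ _ hN X hX
    have hX' : ∀ k l, X l k = -X k l := fun k l => congrFun (congrFun hX k) l
    by_cases h0 : X = 0
    · subst h0
      by_cases hι : Nonempty ι
      · rw [Matrix.det_zero]
        exact IsSquare.zero
      · rw [not_nonempty_iff] at hι
        rw [det_isEmpty]
        exact IsSquare.one
    obtain ⟨i, j, hij⟩ : ∃ i j, X i j ≠ 0 := by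
      by_contra! h
      exact h0 (Matrix.ext h)
    have hdiag : ∀ k, X k k = 0 := fun k => self_eq_neg.mp (hX' k k)
    have hne : i ≠ j := fun h => hij (h ▸ hdiag i)
    -- A nonzero entry is moved into the leading 2 × 2 block. That block has determinant `(X i j)²`,
    -- and its Schur complement is again skew and smaller.
    let f : Fin 2 ⊕ {k // k ≠ i ∧ k ≠ j} → ι := Sum.elim ![i, j] Subtype.val
    have hf : Function.Bijective f := by
      constructor
      · rintro (x | x) (y | y) hxy
        · fin_cases x <;> fin_cases y <;> first | rfl | exact absurd hxy hne | exact absurd hxy.symm hne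
        · exfalso
          fin_cases x
          · exact y.2.1 hxy.symm
          · exact y.2.2 hxy.symm
        · exfalso
          fin_cases y
          · exact x.2.1 hxy
          · exact x.2.2 hxy
        · exact congrArg Sum.inr (Subtype.ext hxy)
      · intro k
        by_cases hi : k = i
        · exact ⟨Sum.inl 0, hi.symm⟩
        by_cases hj : k = j
        · exact ⟨Sum.inl 1, hj.symm⟩
        exact ⟨Sum.inr ⟨k, hi, hj⟩, rfl⟩
    let ε := Equiv.ofBijective f hf
    let Y := X.submatrix ε ε
    have hYdet : Y.det = X.det := det_submatrix_equiv_self ε X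
    have hY : Yᵀ = -Y := by
      ext k l
      exact hX' _ _
    let A := Y.toBlocks₁₁
    let B := Y.toBlocks₁₂
    let C := Y.toBlocks₂₁
    let D := Y.toBlocks₂₂
    have hA : Aᵀ = -A := by
      ext k l
      exact hX' _ _
    have hC : C = -Bᵀ := by
      ext k l
      exact hX' _ _
    have hD : Dᵀ = -D := by
      ext k l
      exact hX' _ _
    have hAdet : A.det = X i j * X i j := by
      rw [det_fin_two]
      change X i i * X j j - X i j * X j i = _
      rw [hdiag i, hX' i j]
      ring
    have hAu : IsUnit A.det := by
      rw [hAdet, isUnit_iff_ne_zero]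
      exact mul_ne_zero hij hij
    let _ : Invertible A := invertibleOfIsUnitDet A hAu
    have hAinv : (⅟A)ᵀ = -⅟A := by
      rw [invOf_eq_nonsing_inv, transpose_nonsing_inv, hA]
      refine inv_eq_left_inv ?_
      rw [neg_mul_neg, nonsing_inv_mul _ hAu]
    have hS : (D - C * ⅟A * B)ᵀ = -(D - C * ⅟A * B) := by
      rw [transpose_sub, transpose_mul, transpose_mul, hAinv, hC, hD, transpose_neg,
        transpose_transpose]
      simp only [Matrix.neg_mul, Matrix.mul_neg, neg_neg, Matrix.mul_assoc, neg_sub]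
      abel
    have hcard : Fintype.card {k // k ≠ i ∧ k ≠ j} < N := by
      rw [← hN]
      exact Fintype.card_subtype_lt (x := i) (by simp)
    obtain ⟨d, hd⟩ := ih _ hcard rfl _ hS
    refine ⟨X i j * d, ?_⟩
    rw [← hYdet, ← fromBlocks_toBlocks Y]
    change (fromBlocks A B C D).det = _
    rw [det_fromBlocks₁₁, hAdet, hd]
    ring

variable (ι : Type*) [Fintype ι] [DecidableEq ι]

/-- The generic skew-symmetric matrix. -/
def genericSkew : Matrix ι ι (MvPolynomial (ι × ι) ℂ) :=
  of fun i j => MvPolynomial.X (i, j) - MvPolynomial.X (j, i)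

/-- The square root exists in the fraction field; it is integral over the polynomial ring, which is
integrally closed. -/
theorem exists_mul_self_eq_det_genericSkew :
    ∃ p : MvPolynomial (ι × ι) ℂ, p * p = (genericSkew ι).det := by
  let K := FractionRing (MvPolynomial (ι × ι) ℂ)
  let c := algebraMap (MvPolynomial (ι × ι) ℂ) K
  have hX : (c.mapMatrix (genericSkew ι))ᵀ = -c.mapMatrix (genericSkew ι) := by
    ext i j
    simp [genericSkew]
  have : CharZero K := charZero_of_injective_algebraMap (R := MvPolynomial (ι × ι) ℂ)
    (IsFractionRing.injective _ _)
  obtain ⟨d, hd⟩ := isSquare_det_of_transpose_eq_neg _ rfl _ hX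
  rw [← RingHom.map_det] at hd
  obtain ⟨p, hp⟩ := IsIntegrallyClosed.exists_algebraMap_eq_of_isIntegral_pow
    (R := MvPolynomial (ι × ι) ℂ) (K := K) (x := d) two_pos (by
      rw [pow_two, ← hd]
      exact isIntegral_algebraMap)
  refine ⟨p, IsFractionRing.injective (MvPolynomial (ι × ι) ℂ) K ?_⟩
  rw [map_mul, hp, ← hd]

/-- A polynomial whose square is the determinant of the generic skew-symmetric matrix. -/
def pfaffianPolynomial : MvPolynomial (ι × ι) ℂ :=
  (exists_mul_self_eq_det_genericSkew ι).choose

variable {ι} {S : Type*} [CommRing S] [Algebra ℂ S]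

/-- A Pfaffian of a skew-symmetric matrix. -/
def pfaffian (X : Matrix ι ι S) : S :=
  -- The generic matrix has entries `X_ij - X_ji`, so for skew `X` it specializes at `X / 2` to `X`
  -- itself.
  MvPolynomial.aeval (fun s : ι × ι => (1 / 2 : ℂ) • X s.1 s.2) (pfaffianPolynomial ι)

theorem map_pfaffian {T : Type*} [CommRing T] [Algebra ℂ T] (f : S →ₐ[ℂ] T) (X : Matrix ι ι S) :
    f (pfaffian X) = pfaffian (f.mapMatrix X) := by
  rw [pfaffian, MvPolynomial.comp_aeval_apply, pfaffian]
  simp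

theorem pfaffian_mul_self {X : Matrix ι ι S} (hX : Xᵀ = -X) :
    pfaffian X * pfaffian X = X.det := by
  rw [pfaffian, ← map_mul, pfaffianPolynomial, (exists_mul_self_eq_det_genericSkew ι).choose_spec,
    AlgHom.map_det]
  congr 1
  ext i j
  have h : X j i = -X i j := congrFun (congrFun hX i) j
  simp only [genericSkew, AlgHom.mapMatrix_apply, map_apply, of_apply, map_sub,
    MvPolynomial.aeval_X, h, smul_neg, sub_neg_eq_add, ← add_smul]
  norm_num

/-- For generic `g` and `X` the squares of both sides agree in a domain, so the identity holds up to
one universal sign. -/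
theorem pfaffian_congruence (g : Matrix ι ι S) {X : Matrix ι ι S} (hX : Xᵀ = -X) :
    pfaffian (g * X * gᵀ) = g.det * pfaffian X := by
  let gU : Matrix ι ι (MvPolynomial ((ι × ι) ⊕ (ι × ι)) ℂ) := of fun i j => MvPolynomial.X (Sum.inl (i, j))
  let XU : Matrix ι ι (MvPolynomial ((ι × ι) ⊕ (ι × ι)) ℂ) := of fun i j =>
    MvPolynomial.X (Sum.inr (i, j)) - MvPolynomial.X (Sum.inr (j, i))
  have hXU : XUᵀ = -XU := by
    ext i j
    simp [XU]
  have hgXU : (gU * XU * gUᵀ)ᵀ = -(gU * XU * gUᵀ) := by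
    rw [transpose_mul, transpose_mul, transpose_transpose, hXU]
    simp only [Matrix.neg_mul, Matrix.mul_neg, Matrix.mul_assoc]
  have hsq : pfaffian (gU * XU * gUᵀ) * pfaffian (gU * XU * gUᵀ)
      = (gU.det * pfaffian XU) * (gU.det * pfaffian XU) := by
    rw [pfaffian_mul_self hgXU, det_mul, det_mul, det_transpose, ← pfaffian_mul_self hXU]
    ring
  let spec : ∀ g : Matrix ι ι S, MvPolynomial ((ι × ι) ⊕ (ι × ι)) ℂ →ₐ[ℂ] S := fun g => MvPolynomial.aeval
    (Sum.elim (fun s => g s.1 s.2) (fun s => (1 / 2 : ℂ) • X s.1 s.2))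
  have hsg : ∀ g, (spec g).mapMatrix gU = g := by
    intro g
    ext i j
    simp [spec, gU]
  have hsX : ∀ g, (spec g).mapMatrix XU = X := by
    intro g
    ext i j
    have h : X j i = -X i j := congrFun (congrFun hX i) j
    simp only [XU, spec, AlgHom.mapMatrix_apply, map_apply, of_apply, map_sub,
      MvPolynomial.aeval_X, Sum.elim_inr, h, smul_neg, sub_neg_eq_add, ← add_smul]
    norm_num
  have hsgX : ∀ g, spec g (pfaffian (gU * XU * gUᵀ)) = pfaffian (g * X * gᵀ) := by
    intro g
    rw [map_pfaffian, map_mul, map_mul, hsX, hsg]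
    congr 3
    rw [AlgHom.mapMatrix_apply, transpose_map, ← AlgHom.mapMatrix_apply, hsg]
  have hs2 : ∀ g, spec g (gU.det * pfaffian XU) = g.det * pfaffian X := by
    intro g
    rw [map_mul, map_pfaffian, AlgHom.map_det, hsX, hsg]
  rcases mul_self_eq_mul_self_iff.mp hsq with h | h
  · rw [← hsgX, h, hs2]
  -- With the wrong sign, `g = 1` forces the Pfaffian to vanish, and the formula still holds.
  · have h1 : ∀ g, pfaffian (g * X * gᵀ) = -(g.det * pfaffian X) := by
      intro g
      rw [← hsgX, h, map_neg, hs2]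
    have h2 : pfaffian X = 0 := by
      have h3 := h1 1
      rw [transpose_one, det_one, one_mul, mul_one, one_mul] at h3
      have h4 : (2 : ℂ) • pfaffian X = 0 := by
        rw [two_smul]
        nth_rewrite 1 [h3]
        simp
      simpa using congrArg (fun x => (1 / 2 : ℂ) • x) h4
    rw [h1 g, h2, mul_zero, neg_zero]

end Pfaffian

/-! ### Deformation of skew-symmetric matrices over commutative rings -/

section Deformation

open Matrix

variable {ι S : Type*} [Fintype ι] [DecidableEq ι] [CommRing S]

/-- The coefficient of index `k` is homogeneous of degree `card ι - k` in the matrix; the factor `u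
^ k` avoids the subtraction. -/
theorem pow_mul_charpoly_smul_coeff (u : S) (X : Matrix ι ι S) (k : ℕ) :
    u ^ k * (u • X).charpoly.coeff k = u ^ Fintype.card ι * X.charpoly.coeff k := by
  have h : (u • X).charpoly.comp (Polynomial.C u * Polynomial.X)
      = Polynomial.C (u ^ Fintype.card ι) * X.charpoly := by
    rw [Matrix.charpoly, Matrix.charpoly, ← Polynomial.coe_compRingHom_apply, RingHom.map_det,
      Polynomial.C_pow, ← det_smul]
    congr 1
    ext1 i j
    by_cases hij : i = j
    · subst hij
      simp [charmatrix_apply_eq, mul_sub]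
    · simp [charmatrix_apply_ne _ _ _ hij]
  have h' := congrArg (fun p => Polynomial.coeff p k) h
  simp only [Polynomial.comp_C_mul_X_coeff, Polynomial.coeff_C_mul] at h'
  rw [← h', mul_comm]

theorem mul_eq_zero_of_mem_span {s : Set S} {c : S} (h : ∀ x ∈ s, c * x = 0) {y : S}
    (hy : y ∈ Ideal.span s) : c * y = 0 := by
  induction hy using Submodule.span_induction with
  | mem x hx => exact h x hx
  | zero => exact mul_zero c
  | add x y _ _ hx hy => rw [mul_add, hx, hy, add_zero]
  | smul a x _ hx => rw [smul_eq_mul, mul_left_comm, hx, mul_zero]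

theorem mul_eq_zero_of_mem_span_of_mem_span {s : Set S} (h : ∀ x ∈ s, ∀ y ∈ s, x * y = 0) {x y : S}
    (hx : x ∈ Ideal.span s) (hy : y ∈ Ideal.span s) : x * y = 0 := by
  refine mul_eq_zero_of_mem_span (fun z hz => ?_) hy
  rw [mul_comm]
  exact mul_eq_zero_of_mem_span (fun w hw => h z hz w hw) hx

/-- The ideal generated by the entries of a matrix. -/
def entryIdeal (Y : Matrix ι ι S) : Ideal S :=
  Ideal.span (Set.range fun s : ι × ι => Y s.1 s.2)

omit [Fintype ι] [DecidableEq ι] in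
theorem entry_mem_entryIdeal (Y : Matrix ι ι S) (i j : ι) : Y i j ∈ entryIdeal Y :=
  Ideal.subset_span ⟨(i, j), rfl⟩

omit [Fintype ι] [DecidableEq ι] in
theorem mul_eq_zero_of_mem_entryIdeal {Y : Matrix ι ι S} {c : S} (h : ∀ i j, c * Y i j = 0) {y : S}
    (hy : y ∈ entryIdeal Y) : c * y = 0 :=
  mul_eq_zero_of_mem_span (by rintro _ ⟨s, rfl⟩; exact h _ _) hy

omit [Fintype ι] [DecidableEq ι] in
theorem mul_eq_zero_of_mem_entryIdeal_of_mem {Y : Matrix ι ι S}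
    (h : ∀ i j k l, Y i j * Y k l = 0) {x y : S}
    (hx : x ∈ entryIdeal Y) (hy : y ∈ entryIdeal Y) : x * y = 0 :=
  mul_eq_zero_of_mem_span_of_mem_span
    (by rintro _ ⟨s, rfl⟩ _ ⟨t, rfl⟩; exact h _ _ _ _) hx hy

/-- Hence anything compatible with ring maps (characteristic coefficients, determinant, Pfaffian,
traces) changes by an element of `entryIdeal Y` when `Y` is added. -/
theorem map_mk_add_entryIdeal (M Y : Matrix ι ι S) :
    (Ideal.Quotient.mk (entryIdeal Y)).mapMatrix (M + Y)
      = (Ideal.Quotient.mk (entryIdeal Y)).mapMatrix M := by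
  ext i j
  rw [RingHom.mapMatrix_apply, RingHom.mapMatrix_apply, map_apply, map_apply, Ideal.Quotient.eq]
  simpa using entry_mem_entryIdeal Y i j

theorem charpoly_add_coeff_sub_mem (M Y : Matrix ι ι S) (k : ℕ) :
    (M + Y).charpoly.coeff k - M.charpoly.coeff k ∈ entryIdeal Y := by
  rw [← Ideal.Quotient.eq, ← Polynomial.coeff_map, ← Polynomial.coeff_map, ← charpoly_map,
    ← charpoly_map, ← RingHom.mapMatrix_apply, map_mk_add_entryIdeal, RingHom.mapMatrix_apply]

theorem det_add_sub_mem (M Y : Matrix ι ι S) : (M + Y).det - M.det ∈ entryIdeal Y := by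
  rw [← Ideal.Quotient.eq, RingHom.map_det, map_mk_add_entryIdeal, RingHom.map_det]

theorem pfaffian_add_sub_mem [Algebra ℂ S] (M Y : Matrix ι ι S) :
    pfaffian (M + Y) - pfaffian M ∈ entryIdeal Y := by
  rw [← Ideal.Quotient.eq, ← Ideal.Quotient.mkₐ_eq_mk ℂ, map_pfaffian, map_pfaffian]
  exact congrArg _ (map_mk_add_entryIdeal M Y)

theorem trace_pow_add_sub_mem (M Y : Matrix ι ι S) (k : ℕ) :
    ((M + Y) ^ k).trace - (M ^ k).trace ∈ entryIdeal Y := by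
  rw [← Ideal.Quotient.eq, AddMonoidHom.map_trace, AddMonoidHom.map_trace,
    ← RingHom.mapMatrix_apply, ← RingHom.mapMatrix_apply, map_pow, map_pow, map_mk_add_entryIdeal]

theorem one_sub_two_mul_pow {t : S} (ht : t * t = 0) (k : ℕ) :
    (1 - 2 * t) ^ k = 1 - 2 * k * t := by
  induction k with
  | zero => simp
  | succ k ih =>
    rw [pow_succ, ih]
    push_cast
    linear_combination (4 * (k : S)) * ht

theorem one_add_pow_of_sq_zero {t : S} (ht : t * t = 0) (k : ℕ) : (1 + t) ^ k = 1 + k * t := by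
  induction k with
  | zero => simp
  | succ k ih =>
    rw [pow_succ, ih]
    push_cast
    linear_combination (k : S) * ht

/-- A matrix `M + Y` with an infinitesimal conjugation that rescales it by `1 - 2 * t`. -/
structure IsRescalingDeformation (M Y Z : Matrix ι ι S) (t : S) : Prop where
  -- Model: for odd `A` and odd scalars `x`, `y`, take `M = A²`, `Y = yA`, `Z = xA` and `t = xy`.
  ZM : Z * M = M * Z
  YM : Y * M = M * Y
  ZY : Z * Y = -(t • M)
  YZ : Y * Z = t • M
  ZZ : ∀ i j k l, Z i j * Z k l = 0
  YY : ∀ i j k l, Y i j * Y k l = 0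
  tY : ∀ i j, t * Y i j = 0
  tZ : ∀ i j, t * Z i j = 0
  tt : t * t = 0
  transM : Mᵀ = -M
  transY : Yᵀ = -Y
  transZ : Zᵀ = -Z

namespace IsRescalingDeformation

variable {M Y Z : Matrix ι ι S} {t : S} (h : IsRescalingDeformation M Y Z t)

include h

omit [DecidableEq ι] in
theorem ZZ_eq_zero : Z * Z = 0 := by
  ext i j
  rw [mul_apply]
  exact Finset.sum_eq_zero fun k _ => h.ZZ _ _ _ _

omit [DecidableEq ι] in
theorem YY_eq_zero : Y * Y = 0 := by
  ext i j
  rw [mul_apply]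
  exact Finset.sum_eq_zero fun k _ => h.YY _ _ _ _

/-- The first-order term is the commutator `ZY - YZ = -2tM`; since `tY = 0`, it equals `-2t(M + Y)`.
-/
theorem conj_eq : (1 + Z) * (M + Y) * (1 - Z) = (1 - 2 * t) • (M + Y) := by
  have h1 : Z * M * Z = 0 := by rw [h.ZM, mul_assoc, h.ZZ_eq_zero, mul_zero]
  have h2 : t • Z = 0 := by
    ext i j
    exact h.tZ i j
  have h3 : t • Y = 0 := by
    ext i j
    exact h.tY i j
  have h4 : Z * Y * Z = 0 := by
    rw [h.ZY, neg_mul, smul_mul_assoc, ← h.ZM, ← smul_mul_assoc, h2, zero_mul, neg_zero]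
  calc (1 + Z) * (M + Y) * (1 - Z)
      = M + Y + (Z * M - M * Z) + Z * Y - Y * Z - Z * M * Z - Z * Y * Z := by noncomm_ring
    _ = M + Y - (2 : S) • (t • M) - (2 : S) • (t • Y) := by
        rw [h1, h4, h.ZM, h.ZY, h.YZ, h3, two_smul, smul_zero]
        abel
    _ = (1 - 2 * t) • (M + Y) := by
        rw [sub_smul, one_smul, mul_smul, smul_add, smul_add]
        abel

theorem one_add_mul_one_sub : (1 + Z) * (1 - Z) = 1 := by
  have : (1 + Z) * (1 - Z) = 1 - Z * Z := by noncomm_ring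
  rw [this, h.ZZ_eq_zero, sub_zero]

theorem one_sub_mul_one_add : (1 - Z) * (1 + Z) = 1 :=
  mul_eq_one_comm.mp h.one_add_mul_one_sub

theorem charpoly_rescale : ((1 - 2 * t) • (M + Y)).charpoly = (M + Y).charpoly := by
  let u : (Matrix ι ι S)ˣ := ⟨1 + Z, 1 - Z, h.one_add_mul_one_sub, h.one_sub_mul_one_add⟩
  rw [← h.conj_eq, ← inv_eq_right_inv h.one_add_mul_one_sub]
  exact charpoly_units_conj u (M + Y)

variable [Algebra ℂ S]

/-- Conjugation invariance against homogeneity, expanded using `t² = 0`, gives `2(card ι - k) t c =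
0` for the coefficient `c`. -/
theorem mul_charpoly_add_coeff {k : ℕ} (hk : k < Fintype.card ι) :
    t * (M + Y).charpoly.coeff k = 0 := by
  have h1 := pow_mul_charpoly_smul_coeff (1 - 2 * t) (M + Y) k
  rw [h.charpoly_rescale, one_sub_two_mul_pow h.tt, one_sub_two_mul_pow h.tt] at h1
  have h2 : ((2 : ℂ) * (Fintype.card ι - k)) • (t * (M + Y).charpoly.coeff k) = 0 := by
    rw [Algebra.smul_def]
    simp only [map_mul, map_sub, map_natCast, map_ofNat]
    linear_combination h1
  refine (smul_eq_zero.mp h2).resolve_left ?_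
  refine mul_ne_zero two_ne_zero (sub_ne_zero.mpr ?_)
  exact_mod_cast hk.ne'

theorem mul_charpoly_coeff {k : ℕ} (hk : k < Fintype.card ι) :
    t * M.charpoly.coeff k = 0 := by
  have h1 := mul_eq_zero_of_mem_entryIdeal h.tY (charpoly_add_coeff_sub_mem M Y k)
  rw [mul_sub, h.mul_charpoly_add_coeff hk, zero_sub, neg_eq_zero] at h1
  exact h1

/-- Transposition gives `det(1 + Z) = det(1 - Z)`, so `d² = 1` for this determinant `d`; also `(d -
1)² = 0`, since `d - 1` lies in the square-zero ideal of entries of `Z`. Together these give `d =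
1`. -/
theorem det_one_add : (1 + Z).det = 1 := by
  have h1 : (1 - Z).det = (1 + Z).det := by
    rw [← det_transpose, transpose_sub, h.transZ, transpose_one, sub_neg_eq_add]
  have h2 := congrArg det h.one_add_mul_one_sub
  rw [det_mul, h1, det_one] at h2
  have h3 : (1 + Z).det - 1 ∈ entryIdeal Z := by
    have := det_add_sub_mem 1 Z
    rwa [det_one] at this
  have h4 := mul_eq_zero_of_mem_entryIdeal_of_mem h.ZZ h3 h3
  have h5 : (2 : ℂ) • ((1 + Z).det - 1) = 0 := by
    rw [Algebra.smul_def, map_ofNat]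
    linear_combination h2 - h4
  exact sub_eq_zero.mp ((smul_eq_zero.mp h5).resolve_left two_ne_zero)

omit [DecidableEq ι] [Algebra ℂ S] in
theorem transpose_add : (M + Y)ᵀ = -(M + Y) := by
  rw [Matrix.transpose_add, h.transM, h.transY, neg_add]

/-- As `(1 + t)²(1 - 2t) = 1`, congruence by `g = (1 + t)(1 + Z)` fixes `M + Y`, while `det g = 1 +
(card ι) t`. -/
theorem mul_pfaffian [Nonempty ι] : t * pfaffian M = 0 := by
  have h1 : ((1 + t) • (1 + Z)) * (M + Y) * ((1 + t) • (1 + Z))ᵀ = M + Y := by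
    rw [transpose_smul, Matrix.transpose_add, h.transZ, transpose_one, ← sub_eq_add_neg,
      smul_mul_assoc, smul_mul_assoc, mul_smul_comm, h.conj_eq, smul_smul, smul_smul]
    have : (1 + t) * (1 + t) * (1 - 2 * t) = 1 := by
      linear_combination (-3 - 2 * t) * h.tt
    rw [this, one_smul]
  have h2 := pfaffian_congruence ((1 + t) • (1 + Z)) h.transpose_add
  rw [h1, det_smul, h.det_one_add, mul_one, one_add_pow_of_sq_zero h.tt] at h2
  have h3 : (Fintype.card ι : ℂ) • (t * pfaffian (M + Y)) = 0 := by
    rw [Algebra.smul_def, map_natCast]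
    linear_combination -h2
  have h4 := (smul_eq_zero.mp h3).resolve_left (by exact_mod_cast Fintype.card_ne_zero)
  have h5 := mul_eq_zero_of_mem_entryIdeal h.tY (pfaffian_add_sub_mem M Y)
  rw [mul_sub, h4, zero_sub, neg_eq_zero] at h5
  exact h5

theorem add_pow (k : ℕ) : (M + Y) ^ (k + 1) = M ^ (k + 1) + (k + 1 : ℂ) • (Y * M ^ k) := by
  have hc : Commute Y M := h.YM
  induction k with
  | zero => simp
  | succ k ih =>
    rw [pow_succ, ih, add_mul, mul_add, mul_add, smul_mul_assoc, smul_mul_assoc, mul_assoc Y,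
      mul_assoc Y, ← pow_succ, (hc.pow_right k).symm.eq, ← mul_assoc Y Y, h.YY_eq_zero, zero_mul,
      smul_zero, add_zero, ← pow_succ, (hc.pow_right (k + 1)).symm.eq]
    push_cast
    rw [add_smul (k + 1 : ℂ) 1, one_smul, add_assoc, add_comm (Y * M ^ (k + 1))]

/-- Take the trace of Cayley–Hamilton for `X = M + Y`. In the intermediate terms both the
coefficient and the trace lie in the square-zero ideal of entries of `Y`, so only `tr X^n = n tr(Y
M^(n-1))` remains, with `n = card ι`. -/
theorem trace_mul_pow_eq_zero [Nonempty ι]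
    (hchar : ∀ k < Fintype.card ι, M.charpoly.coeff k = 0) (hpf : pfaffian M = 0)
    (htr : ∀ k, (M ^ (k + 1)).trace = 0) :
    (Y * M ^ (Fintype.card ι - 1)).trace = 0 := by
  set X := M + Y with hX
  have hcoeff : ∀ k < Fintype.card ι, X.charpoly.coeff k ∈ entryIdeal Y := by
    intro k hk
    simpa [hchar k hk] using charpoly_add_coeff_sub_mem M Y k
  -- The constant term is multiplied by `tr 1`, which need not lie in the ideal. It vanishes because
  -- the determinant is the square of a Pfaffian that does lie there.
  have hdet : X.det = 0 := by
    rw [← pfaffian_mul_self h.transpose_add]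
    have := pfaffian_add_sub_mem M Y
    rw [hpf, sub_zero] at this
    exact mul_eq_zero_of_mem_entryIdeal_of_mem h.YY this this
  have hc0 : X.charpoly.coeff 0 = 0 := by
    have h1 := det_eq_sign_charpoly_coeff X
    rw [hdet] at h1
    rcases neg_one_pow_eq_or S (Fintype.card ι) with h2 | h2
    · rw [h2, one_mul] at h1
      exact h1.symm
    · rw [h2, neg_one_mul] at h1
      exact neg_eq_zero.mp h1.symm
  nontriviality S
  have hCH := aeval_self_charpoly X
  rw [Polynomial.aeval_eq_sum_range, charpoly_natDegree_eq_dim, Finset.sum_range_succ] at hCH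
  have hlead : X.charpoly.coeff (Fintype.card ι) = 1 := by
    have := X.charpoly_monic.coeff_natDegree
    rwa [charpoly_natDegree_eq_dim] at this
  rw [hlead, one_smul] at hCH
  have htrace := congrArg Matrix.trace hCH
  rw [trace_add, trace_sum, trace_zero, Finset.sum_eq_zero, zero_add] at htrace
  · obtain ⟨m, hm⟩ : ∃ m, Fintype.card ι = m + 1 :=
      Nat.exists_eq_succ_of_ne_zero Fintype.card_ne_zero
    rw [hm, h.add_pow, trace_add, htr, zero_add, trace_smul] at htrace
    rw [hm, Nat.add_sub_cancel]
    exact (smul_eq_zero.mp htrace).resolve_left (by exact_mod_cast Nat.succ_ne_zero m)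
  · intro k hk
    rw [trace_smul, smul_eq_mul]
    cases k with
    | zero => rw [hc0, zero_mul]
    | succ k =>
      refine mul_eq_zero_of_mem_entryIdeal_of_mem h.YY (hcoeff _ (Finset.mem_range.mp hk)) ?_
      simpa [htr] using trace_pow_add_sub_mem M Y (k + 1)

end IsRescalingDeformation

theorem pow_card_eq_zero_of_charpoly_coeff {M : Matrix ι ι S}
    (hchar : ∀ k < Fintype.card ι, M.charpoly.coeff k = 0) : M ^ Fintype.card ι = 0 := by
  nontriviality S
  have hCH := aeval_self_charpoly M
  rw [Polynomial.aeval_eq_sum_range, charpoly_natDegree_eq_dim, Finset.sum_range_succ,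
    Finset.sum_eq_zero, zero_add] at hCH
  · have hlead : M.charpoly.coeff (Fintype.card ι) = 1 := by
      have := M.charpoly_monic.coeff_natDegree
      rwa [charpoly_natDegree_eq_dim] at this
    rwa [hlead, one_smul] at hCH
  · intro k hk
    rw [hchar k (Finset.mem_range.mp hk), zero_smul]

end Deformation

/-! ### Vanishing of traces of high powers -/

section EvenPart

open Matrix

variable (W : Type*) [AddCommGroup W] [Module ℂ W]

/-- The subalgebra of an exterior algebra generated by the products of two vectors. -/
abbrev evenPart : Subalgebra ℂ (ExteriorAlgebra ℂ W) :=
  Algebra.adjoin ℂ {z | ∃ x y : W, z = ExteriorAlgebra.ι ℂ x * ExteriorAlgebra.ι ℂ y}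

theorem ι_mul_ι_mul_ι_mul_ι_comm (x y z w : W) :
    (ExteriorAlgebra.ι ℂ x * ExteriorAlgebra.ι ℂ y) * (ExteriorAlgebra.ι ℂ z * ExteriorAlgebra.ι ℂ w)
      = (ExteriorAlgebra.ι ℂ z * ExteriorAlgebra.ι ℂ w) *
        (ExteriorAlgebra.ι ℂ x * ExteriorAlgebra.ι ℂ y) := by
  set X := ExteriorAlgebra.ι ℂ x
  set Y := ExteriorAlgebra.ι ℂ y
  set Z := ExteriorAlgebra.ι ℂ z
  set T := ExteriorAlgebra.ι ℂ w
  have h1 : Y * Z = -(Z * Y) := ι_mul_ι_comm y z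
  have h2 : X * Z = -(Z * X) := ι_mul_ι_comm x z
  have h3 : Y * T = -(T * Y) := ι_mul_ι_comm y w
  have h4 : X * T = -(T * X) := ι_mul_ι_comm x w
  calc X * Y * (Z * T) = X * (Y * Z) * T := by noncomm_ring
    _ = -((X * Z) * (Y * T)) := by rw [h1]; noncomm_ring
    _ = -((Z * X) * (T * Y)) := by rw [h2, h3]; noncomm_ring
    _ = -(Z * (X * T) * Y) := by noncomm_ring
    _ = Z * T * (X * Y) := by rw [h4]; noncomm_ring

/-- Commutativity makes characteristic polynomials, Cayley–Hamilton and Pfaffians available for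
`A²`. -/
instance : CommRing (evenPart W) :=
  { (evenPart W).toRing with
    mul_comm := (Algebra.isMulCommutative_adjoin ℂ (by
      rintro _ ⟨x, y, rfl⟩ _ ⟨z, w, rfl⟩
      exact ι_mul_ι_mul_ι_mul_ι_comm W x y z w)).is_comm.comm }

variable {W}

/-- The product of two vectors as an element of the even part. -/
def evenMul (x y : W) : evenPart W :=
  ⟨ExteriorAlgebra.ι ℂ x * ExteriorAlgebra.ι ℂ y, Algebra.subset_adjoin ⟨x, y, rfl⟩⟩

theorem contractLeft_map_eq_zero {U : Type*} [AddCommGroup U] [Module ℂ U] (f : U →ₗ[ℂ] W)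
    (φ : Module.Dual ℂ W) (h : ∀ u, φ (f u) = 0) (z : ExteriorAlgebra ℂ U) :
    CliffordAlgebra.contractLeft (Q := (0 : QuadraticForm ℂ W)) φ (ExteriorAlgebra.map f z) = 0 := by
  induction z using CliffordAlgebra.left_induction with
  | algebraMap r =>
    rw [AlgHom.commutes]
    exact CliffordAlgebra.contractLeft_algebraMap (Q := (0 : QuadraticForm ℂ W)) _ _
  | add x y hx hy => rw [map_add, map_add, hx, hy, add_zero]
  | ι_mul x m hx =>
    have h1 : ExteriorAlgebra.map f (CliffordAlgebra.ι 0 m) = ExteriorAlgebra.ι ℂ (f m) :=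
      ExteriorAlgebra.map_apply_ι f m
    rw [map_mul, h1, CliffordAlgebra.contractLeft_ι_mul, hx, h m, zero_smul, mul_zero, sub_zero]

/-- Contraction with `φ` is an antiderivation that kills the image of `f` and sends `w` to `1`, so
it undoes multiplication by `w`. -/
theorem eq_zero_of_ι_mul_map_eq_zero {U : Type*} [AddCommGroup U] [Module ℂ U] (f : U →ₗ[ℂ] W)
    (φ : Module.Dual ℂ W) (h : ∀ u, φ (f u) = 0) {w : W} (hw : φ w = 1) {z : ExteriorAlgebra ℂ U}
    (hz : ExteriorAlgebra.ι ℂ w * ExteriorAlgebra.map f z = 0) : ExteriorAlgebra.map f z = 0 := by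
  have h1 := congrArg (CliffordAlgebra.contractLeft (Q := (0 : QuadraticForm ℂ W)) φ) hz
  rw [CliffordAlgebra.contractLeft_ι_mul, contractLeft_map_eq_zero f φ h, hw, one_smul, mul_zero,
    sub_zero, map_zero] at h1
  exact h1

theorem eq_zero_of_ι_mul_ι_mul_map_eq_zero {U : Type*} [AddCommGroup U] [Module ℂ U]
    (f : U →ₗ[ℂ] W) (φ ψ : Module.Dual ℂ W) (h : ∀ u, φ (f u) = 0) (h' : ∀ u, ψ (f u) = 0)
    {w w' : W} (hw : φ w = 1) (hw' : φ w' = 0) (hw'' : ψ w' = 1) {z : ExteriorAlgebra ℂ U}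
    (hz : ExteriorAlgebra.ι ℂ w * ExteriorAlgebra.ι ℂ w' * ExteriorAlgebra.map f z = 0) :
    ExteriorAlgebra.map f z = 0 := by
  refine eq_zero_of_ι_mul_map_eq_zero f ψ h' hw'' ?_
  rw [mul_assoc] at hz
  have h1 := congrArg (CliffordAlgebra.contractLeft (Q := (0 : QuadraticForm ℂ W)) φ) hz
  rw [CliffordAlgebra.contractLeft_ι_mul, CliffordAlgebra.contractLeft_ι_mul,
    contractLeft_map_eq_zero f φ h, hw, one_smul, hw', zero_smul, mul_zero, sub_zero, mul_zero,
    sub_zero, map_zero] at h1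
  exact h1

end EvenPart

/-! ### The deformation applied to the square of an odd skew matrix. -/

section Vanishing

open Matrix

variable {ι U : Type*} [Fintype ι] [DecidableEq ι] [AddCommGroup U] [Module ℂ U]

/-- The square of the matrix with entries `w i j`, over the even part. -/
def evenSquare (w : ι → ι → U) : Matrix ι ι (evenPart U) :=
  of fun i j => ∑ k, evenMul (w i k) (w k j)

/-- The matrix with entries `x * w i j`, over the even part. -/
def evenScale (x : U) (w : ι → ι → U) : Matrix ι ι (evenPart U) :=
  of fun i j => evenMul x (w i j)

/-- The matrix with entries `w i j`, over the exterior algebra. -/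
def oddMatrix (w : ι → ι → U) : Matrix ι ι (ExteriorAlgebra ℂ U) :=
  of fun i j => ExteriorAlgebra.ι ℂ (w i j)

omit [DecidableEq ι] in
theorem evenSquare_map (w : ι → ι → U) :
    (evenSquare w).map (evenPart U).val = oddMatrix w * oddMatrix w := by
  ext i j
  rw [map_apply, evenSquare, of_apply, map_sum, mul_apply]
  rfl

theorem evenScale_map (x : U) (w : ι → ι → U) :
    (evenScale x w).map (evenPart U).val
      = diagonal (fun _ => ExteriorAlgebra.ι ℂ x) * oddMatrix w := by
  ext i j
  rw [diagonal_mul]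
  rfl

theorem diagonal_ι_mul_oddMatrix (x : U) (w : ι → ι → U) :
    oddMatrix w * diagonal (fun _ => ExteriorAlgebra.ι ℂ x)
      = -(diagonal (fun _ => ExteriorAlgebra.ι ℂ x) * oddMatrix w) := by
  ext i j
  rw [neg_apply, diagonal_mul, mul_diagonal]
  exact ι_mul_ι_comm _ _

omit [Fintype ι] [DecidableEq ι] in
theorem oddMatrix_anticomm (w : ι → ι → U) (i j k l : ι) :
    oddMatrix w i j * oddMatrix w k l = -(oddMatrix w k l * oddMatrix w i j) :=
  ι_mul_ι_comm _ _

omit [Fintype ι] [DecidableEq ι] in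
theorem evenPart_map_injective :
    Function.Injective (fun X : Matrix ι ι (evenPart U) => X.map (evenPart U).val) :=
  Matrix.map_injective Subtype.val_injective

theorem isRescalingDeformation_even {w : ι → ι → U} (hw : ∀ i j, w j i = -w i j) (x y : U) :
    IsRescalingDeformation (evenSquare w) (evenScale y w) (evenScale x w) (evenMul x y) := by
  set X := ExteriorAlgebra.ι ℂ x with hX
  set Y := ExteriorAlgebra.ι ℂ y with hY
  set DX : Matrix ι ι (ExteriorAlgebra ℂ U) := diagonal fun _ => X with hDX
  set DY : Matrix ι ι (ExteriorAlgebra ℂ U) := diagonal fun _ => Y with hDY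
  set A := oddMatrix w with hA
  have hAX : A * DX = -(DX * A) := diagonal_ι_mul_oddMatrix x w
  have hAY : A * DY = -(DY * A) := diagonal_ι_mul_oddMatrix y w
  have hXX : X * X = 0 := ExteriorAlgebra.ι_sq_zero x
  have hYY : Y * Y = 0 := ExteriorAlgebra.ι_sq_zero y
  have hXY : Y * X = -(X * Y) := ι_mul_ι_comm y x
  have hDXY : DY * DX = -(DX * DY) := by
    rw [hDX, hDY, diagonal_mul_diagonal, diagonal_mul_diagonal, hXY]
    exact (diagonal_neg fun _ => X * Y).symm
  have hsc : ∀ (u v u' v' : U), ExteriorAlgebra.ι ℂ u * ExteriorAlgebra.ι ℂ u' = 0 →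
      evenMul u v * evenMul u' v' = 0 := by
    intro u v u' v' h
    refine Subtype.ext ?_
    change ExteriorAlgebra.ι ℂ u * ExteriorAlgebra.ι ℂ v *
      (ExteriorAlgebra.ι ℂ u' * ExteriorAlgebra.ι ℂ v') = 0
    rw [mul_assoc, ← mul_assoc (ExteriorAlgebra.ι ℂ v), ι_mul_ι_comm v u', neg_mul, mul_neg,
      ← mul_assoc, ← mul_assoc, h, zero_mul, zero_mul, neg_zero]
  have htM : (evenMul x y • evenSquare w).map (evenPart U).val = DX * DY * (A * A) := by
    ext i j
    rw [map_apply, Matrix.smul_apply, smul_eq_mul, map_mul, ← map_apply (f := (evenPart U).val),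
      evenSquare_map, hDX, hDY, diagonal_mul_diagonal, diagonal_mul]
    rfl
  constructor
  · refine evenPart_map_injective ?_
    simp only [Matrix.map_mul, evenSquare_map, evenScale_map]
    change DX * A * (A * A) = A * A * (DX * A)
    have : A * A * (DX * A) = A * (A * DX) * A := by noncomm_ring
    rw [this, hAX]
    have : A * -(DX * A) * A = -((A * DX) * (A * A)) := by noncomm_ring
    rw [this, hAX]
    noncomm_ring
  · refine evenPart_map_injective ?_
    simp only [Matrix.map_mul, evenSquare_map, evenScale_map]
    change DY * A * (A * A) = A * A * (DY * A)
    have : A * A * (DY * A) = A * (A * DY) * A := by noncomm_ring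
    rw [this, hAY]
    have : A * -(DY * A) * A = -((A * DY) * (A * A)) := by noncomm_ring
    rw [this, hAY]
    noncomm_ring
  · refine evenPart_map_injective ?_
    have hneg : (-(evenMul x y • evenSquare w)).map (evenPart U).val = -(DX * DY * (A * A)) := by
      rw [← htM]
      ext i j
      simp
    simp only [Matrix.map_mul, evenScale_map, hneg]
    change DX * A * (DY * A) = -(DX * DY * (A * A))
    have : DX * A * (DY * A) = DX * (A * DY) * A := by noncomm_ring
    rw [this, hAY]
    noncomm_ring
  · refine evenPart_map_injective ?_
    simp only [Matrix.map_mul, evenScale_map, htM]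
    change DY * A * (DX * A) = DX * DY * (A * A)
    have : DY * A * (DX * A) = DY * (A * DX) * A := by noncomm_ring
    rw [this, hAX]
    have : DY * -(DX * A) * A = -((DY * DX) * (A * A)) := by noncomm_ring
    rw [this, hDXY]
    noncomm_ring
  · exact fun i j k l => hsc _ _ _ _ hXX
  · exact fun i j k l => hsc _ _ _ _ hYY
  · intro i j
    refine Subtype.ext ?_
    change X * Y * (Y * _) = 0
    rw [mul_assoc, ← mul_assoc Y, hYY, zero_mul, mul_zero]
  · exact fun i j => hsc _ _ _ _ hXX
  · exact hsc _ _ _ _ hXX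
  · refine evenPart_map_injective ?_
    ext1 i j
    -- At exponent `2` the transposition sign is `(-1)^3`, so the square of `A` is skew.
    have h := pow_entry_transpose (a := A)
      (fun i j => by simp [hA, oddMatrix, hw i j]) (oddMatrix_anticomm w) 2 i j
    have h' := congrFun (congrFun (evenSquare_map w) j) i
    have h'' := congrFun (congrFun (evenSquare_map w) i) j
    rw [map_apply] at h' h''
    change (evenPart U).val (evenSquare w j i) = (evenPart U).val (-evenSquare w i j)
    rw [map_neg, h', h'', ← hA, ← pow_two, h]
    norm_num
  · ext1 i j
    refine Subtype.ext ?_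
    simp [evenScale, evenMul, hw i j]
  · ext1 i j
    refine Subtype.ext ?_
    simp [evenScale, evenMul, hw i j]

/-- The exterior algebra over a complex vector space is torsion free. -/
instance : IsAddTorsionFree (ExteriorAlgebra ℂ U) := .of_isTorsionFree ℂ _

variable {w : ι → ι → U}

/-- The elements of the even part coming from the first factor. -/
def evenBase (U : Type*) [AddCommGroup U] [Module ℂ U] : Subalgebra ℂ (evenPart (U × ℂ × ℂ)) :=
  (ExteriorAlgebra.map (LinearMap.inl ℂ U (ℂ × ℂ))).range.comap (evenPart (U × ℂ × ℂ)).val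

omit [DecidableEq ι] in
theorem evenSquare_inl_mem (w : ι → ι → U) (i j : ι) :
    evenSquare (fun i j => ((w i j, 0) : U × ℂ × ℂ)) i j ∈ evenBase U := by
  refine sum_mem fun k _ => ⟨ExteriorAlgebra.ι ℂ (w i k) * ExteriorAlgebra.ι ℂ (w k j), ?_⟩
  change ExteriorAlgebra.map _ _ = ExteriorAlgebra.ι ℂ ((w i k, 0) : U × ℂ × ℂ) *
    ExteriorAlgebra.ι ℂ ((w k j, 0) : U × ℂ × ℂ)
  rw [map_mul, ExteriorAlgebra.map_apply_ι, ExteriorAlgebra.map_apply_ι]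
  rfl

/-- The two extra coordinates of `U × ℂ × ℂ` supply fresh odd variables; they do not occur in `z`,
so they can be cancelled. -/
theorem eq_zero_of_mul_mem_evenBase {z : evenPart (U × ℂ × ℂ)} (hz : z ∈ evenBase U)
    (h : evenMul ((0, 1, 0) : U × ℂ × ℂ) (0, 0, 1) * z = 0) : z = 0 := by
  obtain ⟨y, hy⟩ := hz
  refine Subtype.ext (hy.symm.trans ?_)
  refine eq_zero_of_ι_mul_ι_mul_map_eq_zero (w := (0, 1, 0)) (w' := (0, 0, 1)) _
    (LinearMap.fst ℂ ℂ ℂ ∘ₗ LinearMap.snd ℂ U (ℂ × ℂ))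
    (LinearMap.snd ℂ ℂ ℂ ∘ₗ LinearMap.snd ℂ U (ℂ × ℂ)) ?_ ?_ ?_ ?_ ?_ ?_
  · intro u
    rfl
  · intro u
    rfl
  · rfl
  · rfl
  · rfl
  · have h' := congrArg Subtype.val h
    have hy' : ExteriorAlgebra.map (LinearMap.inl ℂ U (ℂ × ℂ)) y = z.1 := hy
    rw [hy']
    exact h'

omit [Fintype ι] [DecidableEq ι] in
theorem oddMatrix_inl_map (w : ι → ι → U) :
    (oddMatrix w).map (ExteriorAlgebra.map (LinearMap.inl ℂ U (ℂ × ℂ)))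
      = oddMatrix (fun i j => ((w i j, 0) : U × ℂ × ℂ)) := by
  ext i j
  exact ExteriorAlgebra.map_apply_ι _ _

theorem exteriorAlgebra_map_inl_injective (U : Type*) [AddCommGroup U] [Module ℂ U] :
    Function.Injective (ExteriorAlgebra.map (LinearMap.inl ℂ U (ℂ × ℂ))) :=
  ExteriorAlgebra.map_injective ⟨LinearMap.fst ℂ U (ℂ × ℂ), LinearMap.fst_comp_inl ℂ U _⟩

theorem exists_evenSquare_eq_map (w : ι → ι → U) : ∃ M₀ : Matrix ι ι (evenBase U),
    (evenBase U).val.mapMatrix M₀ = evenSquare (fun i j => ((w i j, 0) : U × ℂ × ℂ)) :=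
  ⟨of fun i j => ⟨_, evenSquare_inl_mem w i j⟩, rfl⟩

theorem charpoly_evenSquare_coeff (hw : ∀ i j, w j i = -w i j) (k : ℕ) (hk : k < Fintype.card ι) :
    (evenSquare (fun i j => ((w i j, 0) : U × ℂ × ℂ))).charpoly.coeff k = 0 := by
  have hdef := isRescalingDeformation_even (w := fun i j => ((w i j, 0) : U × ℂ × ℂ))
    (fun i j => by simp [hw i j]) (0, 1, 0) (0, 0, 1)
  refine eq_zero_of_mul_mem_evenBase ?_ (hdef.mul_charpoly_coeff hk)
  obtain ⟨M₀, hM₀⟩ := exists_evenSquare_eq_map w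
  rw [← hM₀]
  have := charpoly_map M₀ (evenBase U).val.toRingHom
  change (M₀.map (evenBase U).val.toRingHom).charpoly.coeff k ∈ _
  rw [this, Polynomial.coeff_map]
  exact (M₀.charpoly.coeff k).2

theorem pfaffian_evenSquare [Nonempty ι] (hw : ∀ i j, w j i = -w i j) :
    pfaffian (evenSquare (fun i j => ((w i j, 0) : U × ℂ × ℂ))) = 0 := by
  have hdef := isRescalingDeformation_even (w := fun i j => ((w i j, 0) : U × ℂ × ℂ))
    (fun i j => by simp [hw i j]) (0, 1, 0) (0, 0, 1)
  refine eq_zero_of_mul_mem_evenBase ?_ hdef.mul_pfaffian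
  obtain ⟨M₀, hM₀⟩ := exists_evenSquare_eq_map w
  rw [← hM₀, ← map_pfaffian]
  exact (pfaffian M₀).2

theorem val_trace_pow_evenSquare (w : ι → ι → U) (k : ℕ) :
    (evenPart U).val ((evenSquare w) ^ k).trace = ((oddMatrix w) ^ (2 * k)).trace := by
  rw [AddMonoidHom.map_trace, ← AlgHom.mapMatrix_apply, map_pow, AlgHom.mapMatrix_apply,
    evenSquare_map, ← pow_two, pow_mul]

/-- The analogue of the Amitsur–Levitzki theorem. -/
theorem oddMatrix_pow_eq_zero (hw : ∀ i j, w j i = -w i j) :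
    (oddMatrix w) ^ (2 * Fintype.card ι) = 0 := by
  have h := pow_card_eq_zero_of_charpoly_coeff (charpoly_evenSquare_coeff hw)
  have h1 := congrArg (evenPart (U × ℂ × ℂ)).val.mapMatrix h
  rw [map_pow, map_zero, AlgHom.mapMatrix_apply, evenSquare_map, ← pow_two, ← pow_mul,
    ← oddMatrix_inl_map, ← AlgHom.mapMatrix_apply, ← map_pow] at h1
  have hinj : Function.Injective (AlgHom.mapMatrix (m := ι)
      (ExteriorAlgebra.map (LinearMap.inl ℂ U (ℂ × ℂ)))) :=
    Matrix.map_injective (exteriorAlgebra_map_inl_injective U)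
  exact hinj (h1.trans (map_zero _).symm)

/-- The analogue of Kostant's theorem. -/
theorem trace_oddMatrix_pow_eq_zero (hw : ∀ i j, w j i = -w i j) :
    ((oddMatrix w) ^ (2 * Fintype.card ι - 1)).trace = 0 := by
  cases isEmpty_or_nonempty ι with
  | inl h => simp [Matrix.trace]
  | inr h =>
    have hdef := isRescalingDeformation_even (w := fun i j => ((w i j, 0) : U × ℂ × ℂ))
      (fun i j => by simp [hw i j]) (0, 1, 0) (0, 0, 1)
    have htr : ∀ k, ((evenSquare (fun i j => ((w i j, 0) : U × ℂ × ℂ))) ^ (k + 1)).trace = 0 := by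
      intro k
      refine Subtype.ext ((val_trace_pow_evenSquare _ _).trans ?_)
      exact trace_pow_eq_zero_of_even (oddMatrix_anticomm _) (k := 2 * k + 1) ⟨k, rfl⟩
    have h1 := hdef.trace_mul_pow_eq_zero (charpoly_evenSquare_coeff hw) (pfaffian_evenSquare hw) htr
    have h2 := congrArg (evenPart (U × ℂ × ℂ)).val h1
    obtain ⟨m, hm⟩ : ∃ m, Fintype.card ι = m + 1 :=
      Nat.exists_eq_succ_of_ne_zero Fintype.card_ne_zero
    rw [map_zero, AddMonoidHom.map_trace, Matrix.map_mul, ← AlgHom.mapMatrix_apply _ (_ ^ _),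
      map_pow, AlgHom.mapMatrix_apply, evenSquare_map, evenScale_map, mul_assoc, ← pow_two,
      ← pow_mul, ← pow_succ', ← oddMatrix_inl_map, ← AlgHom.mapMatrix_apply, ← map_pow] at h2
    have h3 : 2 * (Fintype.card ι - 1) + 1 = 2 * Fintype.card ι - 1 := by omega
    rw [h3, Matrix.trace] at h2
    simp only [diag_apply, diagonal_mul] at h2
    rw [← Finset.mul_sum] at h2
    have h4 : ∑ i, ((ExteriorAlgebra.map (LinearMap.inl ℂ U (ℂ × ℂ))).mapMatrix
        (oddMatrix w ^ (2 * Fintype.card ι - 1))) i i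
        = ExteriorAlgebra.map (LinearMap.inl ℂ U (ℂ × ℂ))
          ((oddMatrix w ^ (2 * Fintype.card ι - 1)).trace) := by
      rw [AddMonoidHom.map_trace]
      rfl
    rw [h4] at h2
    -- The trace of `Y M^(n-1)` has become `y tr A^(2n-1)`, and the fresh variable `y` is cancelled.
    have h5 := eq_zero_of_ι_mul_map_eq_zero (LinearMap.inl ℂ U (ℂ × ℂ))
      (LinearMap.snd ℂ ℂ ℂ ∘ₗ LinearMap.snd ℂ U (ℂ × ℂ)) (fun u => rfl) rfl h2
    exact exteriorAlgebra_map_inl_injective U (h5.trans (map_zero _).symm)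

end Vanishing

/-! ### Homomorphisms from exterior algebras on finitely many generators -/

section LiftOfAnticommute

open Module

variable {R : Type*} [Ring R] [Algebra ℂ R] {r : ℕ} {x : Fin r → R}

theorem linearCombination_sq_eq_zero [IsAddTorsionFree R] (hx : ∀ i j, x i * x j = -(x j * x i))
    (v : Fin r → ℂ) :
    Fintype.linearCombination ℂ x v * Fintype.linearCombination ℂ x v = 0 := by
  refine self_eq_neg.mp ?_
  simp_rw [Fintype.linearCombination_apply, Finset.sum_mul_sum, smul_mul_smul_comm]
  conv_lhs => rw [Finset.sum_comm]
  rw [← Finset.sum_neg_distrib]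
  refine Finset.sum_congr rfl fun i _ => ?_
  rw [← Finset.sum_neg_distrib]
  refine Finset.sum_congr rfl fun j _ => ?_
  rw [hx j i, smul_neg, mul_comm]

/-- The homomorphism from an exterior algebra defined by anticommuting elements. -/
def liftOfAnticommute [IsAddTorsionFree R] (hx : ∀ i j, x i * x j = -(x j * x i)) :
    ExteriorAlgebra ℂ (Fin r → ℂ) →ₐ[ℂ] R :=
  ExteriorAlgebra.lift ℂ ⟨Fintype.linearCombination ℂ x, linearCombination_sq_eq_zero hx⟩

theorem liftOfAnticommute_single [IsAddTorsionFree R] (hx : ∀ i j, x i * x j = -(x j * x i))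
    (i : Fin r) : liftOfAnticommute hx (ExteriorAlgebra.ι ℂ (Pi.single i 1)) = x i := by
  rw [liftOfAnticommute, ExteriorAlgebra.lift_ι_apply]
  simp [Fintype.linearCombination_apply_single]

theorem adjoin_le_range_of_single (φ : ExteriorAlgebra ℂ (Fin r → ℂ) →ₐ[ℂ] R)
    (hφ : ∀ i, φ (ExteriorAlgebra.ι ℂ (Pi.single i 1)) = x i) :
    Algebra.adjoin ℂ (Set.range x) ≤ φ.range := by
  refine Algebra.adjoin_le ?_
  rintro _ ⟨i, rfl⟩
  exact ⟨_, hφ i⟩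

/-- The product of the generators divides every nonzero element up to a scalar. -/
theorem injective_of_map_basis_univ_ne_zero {I : Type*} [LinearOrder I] [Fintype I] {M : Type*}
    [AddCommGroup M] [Module ℂ M] (b : Basis I ℂ M) (φ : ExteriorAlgebra ℂ M →ₐ[ℂ] R)
    (hφ : φ (b.ExteriorAlgebra Finset.univ) ≠ 0) : Function.Injective φ := by
  rw [injective_iff_map_eq_zero]
  intro z hz
  by_contra hz0
  -- Multiplying by the basis element of `sᶜ` leaves only the term of `s`: an index set `t` disjoint
  -- from `sᶜ` lies in `s`, and by minimality equals it.
  obtain ⟨s, hs, hmin⟩ := (b.ExteriorAlgebra.repr z).support.exists_min_image Finset.card (by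
    rw [Finsupp.support_nonempty_iff]
    simpa using hz0)
  rw [Finsupp.mem_support_iff] at hs
  have hprod : ∀ t, b.ExteriorAlgebra.repr z t ≠ 0 → t ≠ s →
      b.ExteriorAlgebra t * b.ExteriorAlgebra sᶜ = 0 := by
    intro t ht hts
    refine ExteriorAlgebra.basis_mul_of_not_disjoint b (⟨t, rfl⟩ : Set.powersetCard I t.card)
      (⟨sᶜ, rfl⟩ : Set.powersetCard I sᶜ.card) fun hd => hts ?_
    rw [disjoint_compl_right_iff] at hd
    exact Finset.eq_of_subset_of_card_le hd (hmin t (Finsupp.mem_support_iff.mpr ht))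
  have hd : Disjoint (⟨s, rfl⟩ : Set.powersetCard I s.card).val
      (⟨sᶜ, rfl⟩ : Set.powersetCard I sᶜ.card).val := disjoint_compl_right
  have htop := ExteriorAlgebra.basis_mul_of_disjoint b _ _ hd
  have hmul : z * b.ExteriorAlgebra sᶜ
      = b.ExteriorAlgebra.repr z s • (b.ExteriorAlgebra s * b.ExteriorAlgebra sᶜ) := by
    conv_lhs => rw [← b.ExteriorAlgebra.sum_repr z]
    rw [Finset.sum_mul, Finset.sum_eq_single s]
    · rw [smul_mul_assoc]
    · intro t _ hts
      by_cases ht : b.ExteriorAlgebra.repr z t = 0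
      · rw [ht, zero_smul, zero_mul]
      · rw [smul_mul_assoc, hprod t ht hts, smul_zero]
    · simp
  have huniv : (Set.powersetCard.disjUnion hd).1 = Finset.univ := by
    ext i
    simp [Set.powersetCard.disjUnion]
  have h := congrArg φ hmul
  rw [map_mul, hz, zero_mul, htop, huniv, map_smul, eq_comm, smul_eq_zero] at h
  rcases h with h | h
  · exact hs h
  · rcases Int.units_eq_one_or (Set.powersetCard.permOfDisjoint hd).sign with h1 | h1
    · rw [h1, one_smul] at h
      exact hφ h
    · rw [h1, Units.neg_smul, one_smul, map_neg, neg_eq_zero] at h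
      exact hφ h

theorem map_basis_mem_graded (𝒜 : ℕ → Submodule ℂ R) [GradedAlgebra 𝒜] {I : Type*} [LinearOrder I]
    {M : Type*} [AddCommGroup M] [Module ℂ M] (b : Basis I ℂ M) (φ : ExteriorAlgebra ℂ M →ₐ[ℂ] R)
    (d : I → ℕ) (hd : ∀ i, φ (ExteriorAlgebra.ι ℂ (b i)) ∈ 𝒜 (d i)) (s : Finset I) :
    φ (b.ExteriorAlgebra s) ∈ 𝒜 (∑ i ∈ s, d i) := by
  rw [ExteriorAlgebra.basis_apply_ofCard b (rfl : s.card = s.card)]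
  simp only [ExteriorAlgebra.ιMulti_family, ExteriorAlgebra.ιMulti_apply, map_list_prod,
    List.map_ofFn]
  have h := SetLike.list_prod_ofFn_mem_graded (A := 𝒜)
    (fun i : Fin s.card => d (s.orderEmbOfFin rfl i))
    (fun i : Fin s.card => φ (ExteriorAlgebra.ι ℂ (b (s.orderEmbOfFin rfl i)))) (fun i => hd _)
  rw [List.sum_ofFn] at h
  have h2 : ∑ i : Fin s.card, d (s.orderEmbOfFin rfl i) = ∑ i ∈ s, d i := by
    conv_rhs => rw [← Finset.image_orderEmbOfFin_univ s rfl]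
    rw [Finset.sum_image fun i _ j _ hij => (s.orderEmbOfFin rfl).injective hij]
  rw [h2] at h
  exact h

/-- A nonzero element of maximal degree in the image of an exterior algebra shows that the product
of the generators is not killed. -/
theorem map_basis_univ_ne_zero_of_graded (𝒜 : ℕ → Submodule ℂ R) [GradedAlgebra 𝒜] {I : Type*}
    [LinearOrder I] [Fintype I] {M : Type*} [AddCommGroup M] [Module ℂ M] (b : Basis I ℂ M)
    (φ : ExteriorAlgebra ℂ M →ₐ[ℂ] R) (d : I → ℕ) (hd0 : ∀ i, 0 < d i)
    (hd : ∀ i, φ (ExteriorAlgebra.ι ℂ (b i)) ∈ 𝒜 (d i)) {t : R} (ht : t ≠ 0)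
    (htd : t ∈ 𝒜 (∑ i, d i)) (htr : t ∈ φ.range) :
    φ (b.ExteriorAlgebra Finset.univ) ≠ 0 := by
  intro h0
  obtain ⟨z, rfl⟩ := htr
  refine ht ?_
  -- All `d i` are positive, so a proper subproduct has smaller degree; if the full product dies,
  -- the image has no component in this degree.
  have hmem : ∀ s, GradedRing.proj 𝒜 (∑ i, d i) (φ (b.ExteriorAlgebra s)) = 0 := by
    intro s
    by_cases hs : s = Finset.univ
    · rw [hs, h0, map_zero]
    · rw [GradedRing.proj_apply]
      refine DirectSum.decompose_of_mem_ne 𝒜 (map_basis_mem_graded 𝒜 b φ d hd s) (ne_of_lt ?_)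
      obtain ⟨i, hi⟩ : ∃ i, i ∉ s := by
        by_contra! h
        exact hs (Finset.eq_univ_of_forall h)
      exact Finset.sum_lt_sum_of_subset (Finset.subset_univ s) (Finset.mem_univ i) hi (hd0 i)
        fun _ _ _ => Nat.zero_le _
  have h1 : GradedRing.proj 𝒜 (∑ i, d i) (φ z) = φ z := by
    rw [GradedRing.proj_apply]
    exact DirectSum.decompose_of_mem_same 𝒜 htd
  change φ z = 0
  rw [← h1]
  conv_lhs => rw [← b.ExteriorAlgebra.sum_repr z]
  rw [map_sum, map_sum]
  refine Finset.sum_eq_zero fun s _ => ?_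
  rw [map_smul, Algebra.smul_def, GradedRing.proj_apply]
  have h2 := hmem s
  rw [GradedRing.proj_apply] at h2
  rw [← Algebra.smul_def, DirectSum.decompose_smul]
  change _ • ((DirectSum.decompose 𝒜 (φ (b.ExteriorAlgebra s)) _ : 𝒜 _) : R) = 0
  rw [h2, smul_zero]

end LiftOfAnticommute

/-! ### The form of maximal degree -/

section TopForm

open Module

variable {V : Type*} [AddCommGroup V] [Module ℂ V] {n : ℕ}

/-- The product of the basis vectors of `Λ₂(V)`. -/
def topForm (e : Basis (Fin n) ℂ V) : ExtAlgLambdaTwo V :=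
  ExteriorAlgebra.ιMulti ℂ _ (lambdaTwoBasis e)

theorem topForm_eq_coe (e : Basis (Fin n) ℂ V) :
    topForm e = (exteriorPower.ιMulti ℂ _ (lambdaTwoBasis e) :
      ⋀[ℂ]^(Fintype.card (Set.powersetCard (Fin n) 2)) (⋀[ℂ]^2 V)) :=
  rfl

theorem topForm_ne_zero (e : Basis (Fin n) ℂ V) : topForm e ≠ 0 := by
  have h : topForm e = extAlgBasis e Finset.univ := by
    rw [extAlgBasis, ExteriorAlgebra.basis_apply_ofCard _ 
      (n := Fintype.card (Set.powersetCard (Fin n) 2)) (Finset.card_fin _)]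
    rw [topForm, ExteriorAlgebra.ιMulti_family]
    congr 1
    ext1 i
    rw [Function.comp_apply]
    congr 1
    exact congrFun (Finset.orderEmbOfFin_unique (Finset.card_fin _) (fun _ => Finset.mem_univ _)
      strictMono_id) i
  rw [h]
  exact (extAlgBasis e).ne_zero _

theorem exists_matrixAction_topForm (e : Basis (Fin n) ℂ V) (G : Matrix (Fin n) (Fin n) ℂ) :
    ∃ c : ℂ, matrixAction e G (topForm e) = c • topForm e := by
  have hfin : Module.finrank ℂ
      (⋀[ℂ]^(Fintype.card (Set.powersetCard (Fin n) 2)) (⋀[ℂ]^2 V)) = 1 := by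
    have : Module.Finite ℂ (⋀[ℂ]^2 V) := Module.Finite.of_basis (lambdaTwoBasis e)
    rw [exteriorPower.finrank_eq, Module.finrank_eq_card_basis (lambdaTwoBasis e), Fintype.card_fin,
      Nat.choose_self]
  have h0 : (exteriorPower.ιMulti ℂ _ (lambdaTwoBasis e) :
      ⋀[ℂ]^(Fintype.card (Set.powersetCard (Fin n) 2)) (⋀[ℂ]^2 V)) ≠ 0 := by
    intro h
    exact topForm_ne_zero e (by rw [topForm_eq_coe, h]; rfl)
  obtain ⟨c, hc⟩ := exists_smul_eq_of_finrank_eq_one hfin h0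
    (exteriorPower.map _ (exteriorPower.map 2 (Matrix.toLin e e G))
      (exteriorPower.ιMulti ℂ _ (lambdaTwoBasis e)))
  refine ⟨c, ?_⟩
  rw [topForm_eq_coe, matrixAction, lambdaTwoAction, exteriorAlgebra_map_coe, ← hc]
  rfl

/-- Each index belongs to `n - 1` pairs. -/
theorem prod_powersetCard_two_prod {R : Type*} [CommMonoid R] (d : Fin n → R) :
    ∏ s : Set.powersetCard (Fin n) 2, ∏ i : Fin 2, d (Set.powersetCard.ofFinEmbEquiv.symm s i)
      = ∏ i, d i ^ (n - 1) := by
  have h1 : ∀ s : Set.powersetCard (Fin n) 2,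
      ∏ i : Fin 2, d (Set.powersetCard.ofFinEmbEquiv.symm s i) = ∏ i ∈ s.1, d i := by
    intro s
    conv_rhs => rw [← Finset.image_orderEmbOfFin_univ s.1 s.2]
    rw [Finset.prod_image fun i _ j _ hij => (s.1.orderEmbOfFin s.2).injective hij]
    rfl
  have h2 : ∏ s : Set.powersetCard (Fin n) 2, ∏ i ∈ s.1, d i
      = ∏ s ∈ Finset.powersetCard 2 (Finset.univ : Finset (Fin n)), ∏ i ∈ s, d i := by
    symm
    refine Finset.prod_subtype _ (fun s => ?_) _
    rw [Finset.mem_powersetCard_univ]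
    rfl
  rw [Finset.prod_congr rfl fun s _ => h1 s, h2]
  rw [Finset.prod_comm' (t' := Finset.univ)
    (s' := fun i => (Finset.powersetCard 2 Finset.univ).filter fun s => {i} ⊆ s) (by simp)]
  refine Finset.prod_congr rfl fun i _ => ?_
  rw [Finset.prod_const, Finset.card_filter_powersetCard_subset _ _ _ (by simp) (by simp)]
  simp

theorem matrixAction_diagonal_topForm (e : Basis (Fin n) ℂ V) (d : Fin n → ℂ) :
    matrixAction e (Matrix.diagonal d) (topForm e) = (∏ i, d i ^ (n - 1)) • topForm e := by
  have h1 : ∀ s : Set.powersetCard (Fin n) 2,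
      exteriorPower.map 2 (Matrix.toLin e e (Matrix.diagonal d)) (e.exteriorPower 2 s)
        = (∏ i : Fin 2, d (Set.powersetCard.ofFinEmbEquiv.symm s i)) • e.exteriorPower 2 s := by
    intro s
    rw [exteriorPower.basis_apply, exteriorPower.ιMulti_family, exteriorPower.map_apply_ιMulti,
      ← AlternatingMap.map_smul_univ]
    congr 1
    ext1 i
    simp [Matrix.toLin_self, Matrix.diagonal_apply]
  have h2 : ∀ k, exteriorPower.map 2 (Matrix.toLin e e (Matrix.diagonal d)) (lambdaTwoBasis e k)
      = (∏ i : Fin 2, d (Set.powersetCard.ofFinEmbEquiv.symm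
          ((Fintype.equivFin (Set.powersetCard (Fin n) 2)).symm k) i)) • lambdaTwoBasis e k := by
    intro k
    rw [lambdaTwoBasis, Basis.reindex_apply, h1]
  rw [← prod_powersetCard_two_prod, ← Equiv.prod_comp (Fintype.equivFin _).symm, topForm,
    ← AlternatingMap.map_smul_univ, matrixAction, lambdaTwoAction, ExteriorAlgebra.map_apply_ιMulti]
  congr 1
  ext1 k
  exact h2 k

/-- The transvection with parameter `c` is both the square of the one with `c / 2` and its conjugate
by a diagonal matrix. The scalar `u` of the latter thus satisfies `u² = u`, which is enough for
nonnegativity. -/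
theorem matrixAction_transvection_topForm (e : Basis (Fin n) ℂ V) {i j : Fin n} (hij : i ≠ j)
    (c : ℂ) : ∃ u : ℝ, 0 ≤ u ∧
      matrixAction e (Matrix.transvection i j c) (topForm e) = (u : ℂ) • topForm e := by
  obtain ⟨u, hu⟩ := exists_matrixAction_topForm e (Matrix.transvection i j (c / 2))
  set D : Matrix (Fin n) (Fin n) ℂ := Matrix.diagonal fun k => if k = i then 2 else 1 with hD
  have hc : D * Matrix.transvection i j (c / 2) = Matrix.transvection i j c * D := by
    ext a b
    rw [hD, Matrix.diagonal_mul, Matrix.mul_diagonal]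
    simp only [Matrix.transvection, Matrix.add_apply, Matrix.one_apply, Matrix.single_apply]
    grind
  have hsq : Matrix.transvection i j c
      = Matrix.transvection i j (c / 2) * Matrix.transvection i j (c / 2) := by
    rw [Matrix.transvection_mul_transvection_same _ _ hij, add_halves]
  have h2 : matrixAction e (Matrix.transvection i j c) (topForm e) = (u * u) • topForm e := by
    rw [hsq, matrixAction_mul, hu, map_smul, hu, smul_smul]
  have h3 := congrArg (fun G => matrixAction e G (topForm e)) hc
  simp only [matrixAction_mul] at h3
  rw [hu, hD, matrixAction_diagonal_topForm, map_smul, map_smul, h2, matrixAction_diagonal_topForm,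
    smul_smul, smul_smul] at h3
  have h4 := smul_left_injective ℂ (topForm_ne_zero e) h3
  have h5 : u = u * u := by
    have hne : (∏ k : Fin n, (if k = i then (2 : ℂ) else 1) ^ (n - 1)) ≠ 0 := by
      refine Finset.prod_ne_zero_iff.mpr fun k _ => pow_ne_zero _ ?_
      split_ifs <;> norm_num
    refine mul_right_cancel₀ hne (h4.trans ?_)
    ring
  have h6 : u = 0 ∨ u = 1 := by
    have : u * (u - 1) = 0 := by linear_combination -h5
    rcases mul_eq_zero.mp this with h | h
    · exact Or.inl h
    · exact Or.inr (sub_eq_zero.mp h)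
  rcases h6 with rfl | rfl
  · exact ⟨0, le_rfl, by rw [h2]; simp⟩
  · exact ⟨1, zero_le_one, by rw [h2]; simp⟩

theorem exists_nonneg_matrixAction_topForm (e : Basis (Fin n) ℂ V) (hn : Odd n)
    (G : Matrix (Fin n) (Fin n) ℝ) : ∃ u : ℝ, 0 ≤ u ∧
      matrixAction e (G.map Complex.ofRealHom) (topForm e) = (u : ℂ) • topForm e := by
  refine Matrix.diagonal_transvection_induction (fun G : Matrix (Fin n) (Fin n) ℝ =>
    ∃ u : ℝ, 0 ≤ u ∧ matrixAction e (G.map Complex.ofRealHom) (topForm e) = (u : ℂ) • topForm e)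
    G ?_ ?_ ?_
  · intro d _
    refine ⟨∏ i, d i ^ (n - 1), Finset.prod_nonneg fun i _ => ?_, ?_⟩
    -- This is where odd `n` matters: the exponent `n - 1` is even.
    · exact (Nat.Odd.sub_odd hn odd_one).pow_nonneg _
    · rw [Matrix.diagonal_map (map_zero _), matrixAction_diagonal_topForm]
      simp
  · intro t
    have h : t.toMatrix.map Complex.ofRealHom = Matrix.transvection t.i t.j (t.c : ℂ) := by
      ext a b
      simp only [Matrix.TransvectionStruct.toMatrix, Matrix.transvection, Matrix.map_apply,
        Matrix.add_apply, Matrix.one_apply, Matrix.single_apply, map_add]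
      split_ifs <;> simp
    rw [h]
    exact matrixAction_transvection_topForm e t.hij _
  · rintro A B ⟨u, hu, hA⟩ ⟨v, hv, hB⟩
    refine ⟨u * v, mul_nonneg hu hv, ?_⟩
    rw [Matrix.map_mul, matrixAction_mul, hB, map_smul, hA, smul_smul, Complex.ofReal_mul, mul_comm]

/-- In odd dimension, the form of maximal degree is a polynomial in the traces. -/
theorem topForm_mem_traceAlgebra (e : Basis (Fin n) ℂ V) (hn : Odd n) :
    topForm e ∈ traceAlgebra (matrixA e) := by
  obtain ⟨W, hW, hW'⟩ := exists_gaussian_average e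
  obtain ⟨l₀, hl₀⟩ := Module.Projective.exists_dual_eq_one ℂ (topForm_ne_zero e)
  obtain ⟨f, -, hf'⟩ := hW' l₀ (topForm e)
  -- The polynomial `f` is the scalar by which a matrix acts on the top form. It is nonnegative on
  -- real matrices and `1` at the identity, so its expectation is nonzero.
  have heval : ∀ (y : Fin n × Fin n → ℂ), matrixAction e (Matrix.of fun i j => y (i, j)) (topForm e)
      = MvPolynomial.eval y f • topForm e := by
    intro y
    obtain ⟨c, hc⟩ := exists_matrixAction_topForm e (Matrix.of fun i j => y (i, j))
    rw [hf' y, hc, map_smul, hl₀, smul_eq_mul, mul_one]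
  have hWt : W (topForm e) = gaussianExpectation _ f • topForm e := by
    refine (Module.forall_dual_apply_eq_zero_iff ℂ _).mp ?_ |> sub_eq_zero.mp
    intro l
    obtain ⟨g, hg, hg'⟩ := hW' l (topForm e)
    have hgf : g = l (topForm e) • f := by
      refine MvPolynomial.funext fun y => ?_
      rw [hg' y, heval y, map_smul, MvPolynomial.smul_eval, smul_eq_mul, mul_comm]
    rw [map_sub, map_smul, ← hg, hgf, map_smul, smul_eq_mul, smul_eq_mul, mul_comm, sub_self]
  have hreal : ∀ G : Matrix (Fin n) (Fin n) ℝ, ∃ u : ℝ, 0 ≤ u ∧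
      MvPolynomial.eval (fun s => ((G s.1 s.2 : ℝ) : ℂ)) f = u := by
    intro G
    obtain ⟨u, hu, hG⟩ := exists_nonneg_matrixAction_topForm e hn G
    refine ⟨u, hu, smul_left_injective ℂ (topForm_ne_zero e) ?_⟩
    exact (heval fun s => ((G s.1 s.2 : ℝ) : ℂ)).symm.trans hG
  have hpos := gaussianExpectation_re_pos f (fun y => by
    obtain ⟨u, hu, h⟩ := hreal (Matrix.of fun i j => y (i, j))
    have h' : MvPolynomial.eval (fun i => (y i : ℂ)) f = u := h
    rw [h']
    simpa using hu) (fun s => (1 : Matrix (Fin n) (Fin n) ℝ) s.1 s.2) (by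
      have h1 : MvPolynomial.eval (fun s => (((1 : Matrix (Fin n) (Fin n) ℝ) s.1 s.2 : ℝ) : ℂ)) f
          = 1 := by
        refine smul_left_injective ℂ (topForm_ne_zero e) ((heval _).symm.trans ?_)
        have h2 : (Matrix.of fun i j => (((1 : Matrix (Fin n) (Fin n) ℝ) i j : ℝ) : ℂ)) = 1 := by
          ext i j
          rw [Matrix.of_apply, Matrix.one_apply, Matrix.one_apply]
          split_ifs <;> simp
        change matrixAction e (Matrix.of fun i j => (((1 : Matrix (Fin n) (Fin n) ℝ) i j : ℝ) : ℂ))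
          (topForm e) = (1 : ℂ) • topForm e
        rw [h2, matrixAction_one, one_smul]
      rw [h1]
      norm_num)
  have hne : gaussianExpectation _ f ≠ 0 := by
    intro h
    rw [h] at hpos
    simp at hpos
  have h := Subalgebra.smul_mem _ (hW (topForm e)) (gaussianExpectation _ f)⁻¹
  rwa [hWt, smul_smul, inv_mul_cancel₀ hne, one_smul] at h

end TopForm

/-! ### Freeness of the generators -/

section Freeness

open Module

variable {V : Type*} [AddCommGroup V] [Module ℂ V] {n : ℕ}

theorem matrixA_pow_entry_mem (e : Fin n → V) (k : ℕ) (i j : Fin n) :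
    (matrixA e ^ k) i j ∈ ⋀[ℂ]^k (⋀[ℂ]^2 V) := by
  induction k generalizing j with
  | zero =>
    rw [pow_zero, Matrix.one_apply]
    split_ifs
    · exact SetLike.one_mem_graded (A := fun k : ℕ => ⋀[ℂ]^k (⋀[ℂ]^2 V))
    · exact zero_mem _
  | succ k ih =>
    rw [pow_succ, Matrix.mul_apply]
    refine sum_mem fun l _ => ?_
    refine SetLike.mul_mem_graded (A := fun k : ℕ => ⋀[ℂ]^k (⋀[ℂ]^2 V)) (ih l) ?_
    exact (pow_one (LinearMap.range (ExteriorAlgebra.ι ℂ (M := ⋀[ℂ]^2 V)))).ge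
      (LinearMap.mem_range_self _ _)

theorem qTrace_mem (e : Fin n → V) (k : ℕ) : qTrace e k ∈ ⋀[ℂ]^k (⋀[ℂ]^2 V) := by
  rw [qTrace, Matrix.trace]
  exact sum_mem fun i _ => matrixA_pow_entry_mem e k i i

theorem ιMulti_two_swap (e : Fin n → V) (i j : Fin n) :
    exteriorPower.ιMulti ℂ 2 ![e j, e i] = -exteriorPower.ιMulti ℂ 2 ![e i, e j] := by
  rw [← (exteriorPower.ιMulti ℂ 2).map_swap ![e i, e j] (i := 0) (j := 1) (by simp)]
  congr 1
  ext l
  fin_cases l <;> rfl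

/-- The bound on `n` says `4r + 3 ≥ 2n - 1`, so every trace beyond the first `r` candidates
vanishes. -/
theorem traceAlgebra_eq_adjoin (e : Fin n → V) {r : ℕ} (hr : n ≤ 2 * r + 2) :
    Algebra.adjoin ℂ (Set.range fun j : Fin r => qTrace e (4 * (j : ℕ) + 3))
      = traceAlgebra (matrixA e) := by
  refine le_antisymm (Algebra.adjoin_mono ?_) (Algebra.adjoin_le ?_)
  · rintro _ ⟨j, rfl⟩
    exact ⟨_, rfl⟩
  · rintro _ ⟨k, rfl⟩
    by_cases hk : (k + 1) % 4 = 3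
    · by_cases hkr : (k + 1) / 4 < r
      · refine Algebra.subset_adjoin ⟨⟨(k + 1) / 4, hkr⟩, ?_⟩
        change qTrace e (4 * ((k + 1) / 4) + 3) = qTrace e (k + 1)
        congr 1
        omega
      · have h0 : (matrixA e ^ (k + 1)).trace = 0 := by
          have hpow : matrixA e ^ (2 * n) = 0 := by
            have h := oddMatrix_pow_eq_zero
              (w := fun i j => exteriorPower.ιMulti ℂ 2 ![e i, e j]) (ιMulti_two_swap e)
            rwa [Fintype.card_fin] at h
          have htr : (matrixA e ^ (2 * n - 1)).trace = 0 := by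
            have h := trace_oddMatrix_pow_eq_zero
              (w := fun i j => exteriorPower.ιMulti ℂ 2 ![e i, e j]) (ιMulti_two_swap e)
            rwa [Fintype.card_fin] at h
          rcases (by omega : 2 * n ≤ k + 1 ∨ k + 1 = 2 * n - 1) with h | h
          · rw [pow_eq_zero_of_le h hpow, Matrix.trace_zero]
          · rw [h, htr]
        rw [h0]
        exact zero_mem _
    · rw [trace_pow_eq_zero_of_mod_ne (matrixA_transpose e) (matrixA_anticomm e) k.succ_ne_zero hk]
      exact zero_mem _

theorem qTrace_anticomm (e : Fin n → V) (i j : ℕ) :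
    qTrace e (4 * i + 3) * qTrace e (4 * j + 3)
      = -(qTrace e (4 * j + 3) * qTrace e (4 * i + 3)) :=
  trace_pow_mul_trace_pow (matrixA_anticomm e) ⟨2 * i + 1, by ring⟩ ⟨2 * j + 1, by ring⟩

/-- The value is the binomial coefficient of `2r + 1` over `2`, the degree of the top form in
dimension `2r + 1`. -/
theorem sum_four_mul_add_three (r : ℕ) : ∑ j : Fin r, (4 * (j : ℕ) + 3) = r * (2 * r + 1) := by
  induction r with
  | zero => rfl
  | succ r ih =>
    rw [Fin.sum_univ_castSucc]
    simp only [Fin.val_castSucc, Fin.val_last, ih]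
    ring

theorem map_basis_univ_ne_zero_of_odd {r : ℕ} (e : Basis (Fin (2 * r + 1)) ℂ V)
    (φ : ExteriorAlgebra ℂ (Fin r → ℂ) →ₐ[ℂ] ExtAlgLambdaTwo V)
    (hφ : ∀ i, φ (ExteriorAlgebra.ι ℂ (Pi.single i 1)) = qTrace e (4 * (i : ℕ) + 3)) :
    φ ((Pi.basisFun ℂ (Fin r)).ExteriorAlgebra Finset.univ) ≠ 0 := by
  refine map_basis_univ_ne_zero_of_graded (fun k : ℕ => ⋀[ℂ]^k (⋀[ℂ]^2 V)) _ φ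
    (fun i : Fin r => 4 * (i : ℕ) + 3) (fun i => Nat.succ_pos _) (fun i => ?_) (topForm_ne_zero e)
    ?_ ?_
  · rw [Pi.basisFun_apply, hφ]
    exact qTrace_mem _ _
  · have h : Fintype.card (Set.powersetCard (Fin (2 * r + 1)) 2)
        = ∑ j : Fin r, (4 * (j : ℕ) + 3) := by
      rw [sum_four_mul_add_three, ← Nat.card_eq_fintype_card, Set.powersetCard.card,
        Nat.card_eq_fintype_card, Fintype.card_fin, Nat.choose_two_right, Nat.add_sub_cancel]
      refine Nat.div_eq_of_eq_mul_left two_pos ?_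
      ring
    rw [← h, topForm_eq_coe]
    exact Subtype.property _
  · refine adjoin_le_range_of_single φ hφ ?_
    rw [traceAlgebra_eq_adjoin e (by omega)]
    exact topForm_mem_traceAlgebra e (odd_two_mul_add_one r)

theorem matrixA_snoc_zero_pow_castSucc (v : Fin n → V) (k : ℕ) (i j : Fin n) :
    (matrixA (Fin.snoc v 0 : Fin (n + 1) → V) ^ k) i.castSucc j.castSucc = (matrixA v ^ k) i j := by
  induction k generalizing j with
  | zero => simp [Matrix.one_apply]
  | succ k ih =>
    rw [pow_succ, pow_succ, Matrix.mul_apply, Matrix.mul_apply, Fin.sum_univ_castSucc]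
    simp only [ih, matrixA_apply, Fin.snoc_castSucc, Fin.snoc_last]
    rw [(exteriorPower.ιMulti ℂ 2).map_coord_zero (m := ![0, v j]) 0 rfl, map_zero, mul_zero,
      add_zero]

theorem qTrace_snoc_zero (v : Fin n → V) (k : ℕ) :
    qTrace (Fin.snoc v 0 : Fin (n + 1) → V) (k + 1) = qTrace v (k + 1) := by
  have hlast : (matrixA (Fin.snoc v 0 : Fin (n + 1) → V) ^ (k + 1)) (Fin.last n) (Fin.last n)
      = 0 := by
    rw [pow_succ, Matrix.mul_apply]
    refine Finset.sum_eq_zero fun l _ => ?_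
    rw [matrixA_apply, (exteriorPower.ιMulti ℂ 2).map_coord_zero 1 (by simp), map_zero,
      mul_zero]
  rw [qTrace, qTrace, Matrix.trace, Matrix.trace, Fin.sum_univ_castSucc]
  simp only [Matrix.diag_apply, matrixA_snoc_zero_pow_castSucc, hlast, add_zero]

theorem map_qTrace {M : Type*} [AddCommGroup M] [Module ℂ M] (f : V →ₗ[ℂ] M) (e : Fin n → V)
    (k : ℕ) :
    ExteriorAlgebra.map (exteriorPower.map 2 f) (qTrace e k) = qTrace (fun i => f (e i)) k := by
  rw [qTrace, AddMonoidHom.map_trace, ← AlgHom.mapMatrix_apply, map_pow, qTrace]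
  congr 2
  ext i j
  rw [AlgHom.mapMatrix_apply, Matrix.map_apply, matrixA_apply, ExteriorAlgebra.map_apply_ι,
    exteriorPower.map_apply_ιMulti, matrixA_apply]
  congr 2

/-- The linear map killing the last basis vector carries each generator to the generator of the same
degree in dimension `2r + 1`, where the product is nonzero. -/
theorem map_basis_univ_ne_zero_of_even {r : ℕ} (e : Basis (Fin (2 * r + 1 + 1)) ℂ V)
    (φ : ExteriorAlgebra ℂ (Fin r → ℂ) →ₐ[ℂ] ExtAlgLambdaTwo V)
    (hφ : ∀ i, φ (ExteriorAlgebra.ι ℂ (Pi.single i 1)) = qTrace e (4 * (i : ℕ) + 3)) :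
    φ ((Pi.basisFun ℂ (Fin r)).ExteriorAlgebra Finset.univ) ≠ 0 := by
  let b := Pi.basisFun ℂ (Fin (2 * r + 1))
  let f := e.constr ℂ (Fin.snoc b 0 : Fin (2 * r + 1 + 1) → (Fin (2 * r + 1) → ℂ))
  intro h
  refine map_basis_univ_ne_zero_of_odd b ((ExteriorAlgebra.map (exteriorPower.map 2 f)).comp φ)
    (fun i => ?_) ?_
  · rw [AlgHom.comp_apply, hφ, map_qTrace]
    have hf : (fun i => f (e i)) = (Fin.snoc b 0 : Fin (2 * r + 1 + 1) → (Fin (2 * r + 1) → ℂ)) :=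
      funext fun i => e.constr_basis ℂ _ i
    rw [hf, qTrace_snoc_zero]
  · rw [AlgHom.comp_apply, h, map_zero]

theorem freelyGenerated_of_map_basis_univ_ne_zero {B : LinearMap.BilinForm ℂ V}
    {e : Basis (Fin n) ℂ V} (he : ∀ i j, B (e i) (e j) = if i = j then 1 else 0) {r : ℕ}
    (hr : n ≤ 2 * r + 2)
    (h : ∀ φ : ExteriorAlgebra ℂ (Fin r → ℂ) →ₐ[ℂ] ExtAlgLambdaTwo V,
      (∀ i, φ (ExteriorAlgebra.ι ℂ (Pi.single i 1)) = qTrace e (4 * (i : ℕ) + 3)) →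
      φ ((Pi.basisFun ℂ (Fin r)).ExteriorAlgebra Finset.univ) ≠ 0) :
    FreelyGeneratedAsExteriorAlgebra (orthogonalInvariants B)
      (fun j : Fin r => qTrace e (4 * (j : ℕ) + 3)) where
  generates := (traceAlgebra_eq_adjoin e hr).trans (traceAlgebra_eq_invariants he)
  anticommute i j := qTrace_anticomm e i j
  no_other_relations := by
    have hx : ∀ i j : Fin r, qTrace e (4 * (i : ℕ) + 3) * qTrace e (4 * (j : ℕ) + 3)
        = -(qTrace e (4 * (j : ℕ) + 3) * qTrace e (4 * (i : ℕ) + 3)) :=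
      fun i j => qTrace_anticomm e i j
    have hφ := liftOfAnticommute_single hx
    exact ⟨liftOfAnticommute hx, hφ,
      injective_of_map_basis_univ_ne_zero (Pi.basisFun ℂ (Fin r)) _ (h _ hφ)⟩

end Freeness

end

theorem theorem4p5 {V : Type*} [AddCommGroup V] [Module ℂ V]
    (B : LinearMap.BilinForm ℂ V) (hsymm : B.IsSymm) (hnondeg : B.Nondegenerate)
    (n : ℕ) (e : Module.Basis (Fin n) ℂ V)
    (he : ∀ i j, B (e i) (e j) = if i = j then 1 else 0) :
    (∀ m : ℕ, n = 2 * m →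
      FreelyGeneratedAsExteriorAlgebra (orthogonalInvariants B)
        (fun j : Fin (m - 1) => qTrace e (4 * (j : ℕ) + 3))) ∧
    (∀ m : ℕ, n = 2 * m + 1 →
      FreelyGeneratedAsExteriorAlgebra (orthogonalInvariants B)
        (fun j : Fin m => qTrace e (4 * (j : ℕ) + 3))) := by
  constructor
  · rintro m rfl
    refine freelyGenerated_of_map_basis_univ_ne_zero he (by omega) fun φ hφ => ?_
    rcases m with _ | r
    -- In dimension zero the truncated `0 - 1` leaves no generators, and the empty product is `1`.
    · have h1 : (Pi.basisFun ℂ (Fin (0 - 1))).ExteriorAlgebra Finset.univ = 1 := by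
        rw [ExteriorAlgebra.basis_apply_ofCard _ (n := 0) (Finset.card_fin 0),
          ExteriorAlgebra.ιMulti_family, ExteriorAlgebra.ιMulti_zero_apply]
      rw [h1, map_one]
      exact one_ne_zero
    · exact map_basis_univ_ne_zero_of_even e φ hφ
  · rintro m rfl
    exact freelyGenerated_of_map_basis_univ_ne_zero he (by omega) fun φ hφ =>
      map_basis_univ_ne_zero_of_odd e φ hφ
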